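/- Let $\Theta=((0,\infty)\times(0,\infty))^{\mathbb Z}$ with the product $\sigma$-algebra, write $\xi=((r_x^-,r_x^+))_{x\in\mathbb Z}$ for its elements, and put $\rho_x:=r_x^- /r_x^+$. Let $\mathbb P$ be a probability measure on $\Theta$, with expectation $\mathbb E$, that is stationary and ergodic with respect to the shift $(\theta\xi)_x=\xi_{x+1}$ and for which $\mathbb E[\log\rho_0]$ is well defined, with $\pm\infty$ as possible values. Fix $\lambda\in\mathbb R$ and set $r_x^{\pm}(\lambda):=r_x^{\pm}e^{\pm\lambda}$ and $\rho_x(\lambda):=r_x^-(\lambda)/r_x^+(\lambda)=\rho_x e^{-2\lambda}$. Given $\xi$, let $(Y_t^{\xi,\lambda})_{t\ge 0}$, with law $P_0^{\xi,\lambda}$, be the continuous-time nearest-neighbour random walk on $\mathbb Z$ started at $0$ which jumps from $x$ to $x\pm1$ at rate $r_x^{\pm}(\lambda)$. Define the $[0,\infty]$-valued random variables $$\hat S(\lambda):=\frac1{r_0^+(\lambda)}+\sum_{i=1}^\infty\frac1{r_{-i}^+(\lambda)}\prod_{j=0}^{i-1}\rho_{-j}(\lambda),\qquad \hat F(\lambda):=\frac1{r_0^-(\lambda)}+\sum_{i=1}^\infty\frac1{r_i^-(\lambda)}\prod_{j=0}^{i-1}\rho_j(\lambda)^{-1}.$$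 **Proposition 4.1.** $\mathbb P\otimes P_0^{\xi,\lambda}$-almost surely the walk does not explode (so that it is defined for all times), and the limit $v_Y(\lambda):=\lim_{t\to\infty}Y_t^{\xi,\lambda}/t$ exists and is a deterministic real number, characterized as follows: (a) if $\mathbb E[\hat S(\lambda)]<\infty$, then $v_Y(\lambda)=1/\mathbb E[\hat S(\lambda)]$; (b) if $\mathbb E[\hat F(\lambda)]<\infty$, then $v_Y(\lambda)=-1/\mathbb E[\hat F(\lambda)]$; (c) if $\mathbb E[\hat S(\lambda)]=\infty$ and $\mathbb E[\hat F(\lambda)]=\infty$, then $v_Y(\lambda)=0$. -/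

import Mathlib

open MeasureTheory ProbabilityTheory Filter Topology
open scoped ENNReal

noncomputable section

namespace BiasedWalk

/-- An environment `ξ = ((r_x⁻, r_x⁺))_{x ∈ ℤ}` of positive jump rates; the space carries the
product σ-algebra. -/
abbrev Env : Type := ℤ → Set.Ioi (0 : ℝ) × Set.Ioi (0 : ℝ)

/-- The spatial shift `(θ ξ)_x = ξ_{x+1}`. -/
def shift (ξ : Env) : Env := fun x => ξ (x + 1)

/-- The biased rate `r_x⁻(lam) = r_x⁻ e^{-lam}` of the jump `x → x - 1`. -/
def rateLeft (lam : ℝ) (ξ : Env) (x : ℤ) : ℝ := ((ξ x).1 : ℝ) * Real.exp (-lam)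

/-- The biased rate `r_x⁺(lam) = r_x⁺ e^{lam}` of the jump `x → x + 1`. -/
def rateRight (lam : ℝ) (ξ : Env) (x : ℤ) : ℝ := ((ξ x).2 : ℝ) * Real.exp lam

/-- `ρ_x(lam) = r_x⁻(lam) / r_x⁺(lam)`. -/
def rho (lam : ℝ) (ξ : Env) (x : ℤ) : ℝ := rateLeft lam ξ x / rateRight lam ξ x

/-- `Ŝ(lam) = 1 / r_0⁺(lam) + ∑_{i ≥ 1} (1 / r_{-i}⁺(lam)) ∏_{j=0}^{i-1} ρ_{-j}(lam)`,
with values in `[0, ∞]`. The summation index below is `i - 1`. -/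
def hatS (lam : ℝ) (ξ : Env) : ℝ≥0∞ :=
  ENNReal.ofReal (1 / rateRight lam ξ 0) +
    ∑' i : ℕ, ENNReal.ofReal
      (1 / rateRight lam ξ (-((i : ℤ) + 1)) * ∏ j ∈ Finset.range (i + 1), rho lam ξ (-(j : ℤ)))

/-- `F̂(lam) = 1 / r_0⁻(lam) + ∑_{i ≥ 1} (1 / r_i⁻(lam)) ∏_{j=0}^{i-1} ρ_j(lam)⁻¹`,
with values in `[0, ∞]`. The summation index below is `i - 1`. -/
def hatF (lam : ℝ) (ξ : Env) : ℝ≥0∞ :=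
  ENNReal.ofReal (1 / rateLeft lam ξ 0) +
    ∑' i : ℕ, ENNReal.ofReal
      (1 / rateLeft lam ξ ((i : ℤ) + 1) * ∏ j ∈ Finset.range (i + 1), (rho lam ξ (j : ℤ))⁻¹)

/-- The randomness driving the walk in a fixed environment: at step `n` a pair `(γ_n, W_n)`. -/
abbrev Noise : Type := ℕ → unitInterval × ℝ

/-- The law of the noise: all `γ_n` and `W_n` are independent, `γ_n` is uniform on `[0, 1]` and
`W_n` is exponential with mean `1`. -/
def noiseLaw : Measure Noise :=
  haveI : IsProbabilityMeasure (expMeasure 1) := isProbabilityMeasure_expMeasure one_pos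
  Measure.infinitePi fun _ : ℕ => (volume : Measure unitInterval).prod (expMeasure 1)

/-- The jump chain, started at `0`: from `x` it moves to `x + 1` with probability
`r_x⁺(lam) / (r_x⁻(lam) + r_x⁺(lam))` and to `x - 1` otherwise. -/
def jumpChain (lam : ℝ) (ξ : Env) (ω : Noise) : ℕ → ℤ
  | 0 => 0
  | n + 1 =>
    let x := jumpChain lam ξ ω n
    if ((ω n).1 : ℝ) ≤ rateRight lam ξ x / (rateLeft lam ξ x + rateRight lam ξ x)
    then x + 1 else x - 1

/-- The holding time before jump `n + 1`: given the jump chain, an exponential variable whose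
parameter is the total rate `r_x⁻(lam) + r_x⁺(lam)` at the current site `x`. -/
def holdingTime (lam : ℝ) (ξ : Env) (ω : Noise) (n : ℕ) : ℝ :=
  (ω n).2 / (rateLeft lam ξ (jumpChain lam ξ ω n) + rateRight lam ξ (jumpChain lam ξ ω n))

/-- The time of the `n`-th jump (`0` for `n = 0`). -/
def jumpTime (lam : ℝ) (ξ : Env) (ω : Noise) (n : ℕ) : ℝ :=
  ∑ k ∈ Finset.range n, holdingTime lam ξ ω k

/-- The continuous-time walk `Y_t`: the position of the jump chain after the last jump that
occurred up to time `t`. It is meaningful for all `t ≥ 0` when the jump times tend to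
infinity (no explosion). -/
def walk (lam : ℝ) (ξ : Env) (ω : Noise) (t : ℝ) : ℤ :=
  jumpChain lam ξ ω (sSup {n : ℕ | jumpTime lam ξ ω n ≤ t})

end BiasedWalk

end

/-! The argument follows the walk through its first visits to the levels 1, 2, 3, .... Each such
visit shifts the environment by one site and leaves fresh i.i.d. marks, so if the walk is almost
surely unbounded above, the map `Φ 1` to the picture at the first visit to level 1 preserves the
annealed law and is ergodic (`measurePreserving_Φ`, `ergodic_Φ`). The hitting time of level k is
then a Birkhoff sum of `τ`, the hitting time of level 1, and grows like k times the mean of `τ`.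

That mean is computed by balancing flows across edges. Before level 1 is reached, the expected
number of right crossings of an edge to the left of the origin is at most the expected number of
left crossings, with equality if level 1 is certain to be reached. This gives a recursion for the
expected time at each site, solved by the terms of Ŝ (`timeAt_le`, `timeAt_eq`). Thus E[Ŝ] is the
annealed mean of `τ` when the walk is unbounded above.

The same bounds make the expected number of visits to each site before level 1 finite, so the walk
is almost surely unbounded above or almost surely unbounded below (`unb_ae_or_mirror_unb_ae`).
Reflection exchanges the cases and Ŝ with F̂, and in either one linear growth of the hitting times
rules out explosion.

The bound on the velocity from above needs only that at level at most i the clock is past the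
hitting time of i; truncating `τ` covers infinite means. For the bound from below when E[Ŝ] is
finite, the walk must not retreat far from its maximum. A Borel–Cantelli type argument shows that it
is bounded below (`ae_bddBelow`), so for large K a proportion near 1 of the levels j are such that
the walk never falls below j - K after reaching j (`ae_eventually_clk_le_mul_X`). If both means are
infinite, the upper bounds for the walk and its reflection give velocity zero. -/

/-! ### The maximal ergodic theorem and one-sided pointwise ergodic bounds. -/

section Birkhoff

variable {α : Type*}

/-- The largest of the Birkhoff sums `S_0 = 0, S_1, …, S_n` of `g`. -/
noncomputable def birkhoffMax (f : α → α) (g : α → ℝ) : ℕ → α → ℝ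
  | 0 => fun _ => 0
  | n + 1 => fun x => max 0 (g x + birkhoffMax f g n (f x))

lemma birkhoffMax_nonneg (f : α → α) (g : α → ℝ) (n : ℕ) (x : α) : 0 ≤ birkhoffMax f g n x := by
  cases n with
  | zero => exact le_rfl
  | succ n => exact le_max_left _ _

lemma birkhoffMax_le_succ (f : α → α) (g : α → ℝ) (n : ℕ) (x : α) :
    birkhoffMax f g n x ≤ birkhoffMax f g (n + 1) x := by
  induction n generalizing x with
  | zero => exact birkhoffMax_nonneg f g 1 x
  | succ n ih => exact max_le_max le_rfl (by gcongr; exact ih (f x))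

lemma birkhoffMax_mono (f : α → α) (g : α → ℝ) (x : α) :
    Monotone fun n => birkhoffMax f g n x :=
  monotone_nat_of_le_succ fun n => birkhoffMax_le_succ f g n x

lemma birkhoffSum_le_birkhoffMax (f : α → α) (g : α → ℝ) (n : ℕ) (x : α) :
    birkhoffSum f g n x ≤ birkhoffMax f g n x := by
  induction n generalizing x with
  | zero => simp [birkhoffMax]
  | succ n ih =>
    rw [birkhoffSum_succ']
    exact le_max_of_le_right (by gcongr; exact ih (f x))

/-- The difference has nonnegative integral under an invariant measure, while the right side becomes
`g x` once the maxima at `f x` are large. Comparing the two yields the maximal ergodic theorem. -/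
lemma birkhoffMax_succ_sub (f : α → α) (g : α → ℝ) (n : ℕ) (x : α) :
    birkhoffMax f g (n + 1) x - birkhoffMax f g n (f x)
      = max (-birkhoffMax f g n (f x)) (g x) := by
  simp only [birkhoffMax]
  rw [← max_sub_sub_right]
  simp

/-- Makes boundedness of the maxima an invariant event, to which ergodicity applies. -/
lemma bddAbove_range_birkhoffMax_comp (f : α → α) (g : α → ℝ) (x : α) :
    BddAbove (Set.range fun n => birkhoffMax f g n (f x)) ↔
      BddAbove (Set.range fun n => birkhoffMax f g n x) := by
  constructor
  · rintro ⟨B, hB⟩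
    refine ⟨max 0 (g x + B), ?_⟩
    rintro _ ⟨n, rfl⟩
    refine (birkhoffMax_le_succ f g n x).trans (max_le_max le_rfl ?_)
    gcongr
    exact hB ⟨n, rfl⟩
  · rintro ⟨B, hB⟩
    refine ⟨B - g x, ?_⟩
    rintro _ ⟨n, rfl⟩
    have h1 : birkhoffMax f g (n + 1) x ≤ B := hB ⟨n + 1, rfl⟩
    have h2 : g x + birkhoffMax f g n (f x) ≤ birkhoffMax f g (n + 1) x := le_max_right _ _
    show birkhoffMax f g n (f x) ≤ B - g x
    linarith

variable [MeasurableSpace α] {μ : Measure α} {f : α → α} {g : α → ℝ}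

lemma measurable_birkhoffMax (hf : Measurable f) (hg : Measurable g) (n : ℕ) :
    Measurable (birkhoffMax f g n) := by
  induction n with
  | zero => exact measurable_const
  | succ n ih => exact measurable_const.max (hg.add (ih.comp hf))

lemma integrable_birkhoffMax [IsFiniteMeasure μ] (hf : MeasurePreserving f μ μ)
    (hg : Integrable g μ) (n : ℕ) :
    Integrable (birkhoffMax f g n) μ := by
  induction n with
  | zero => exact integrable_zero _ _ _
  | succ n ih =>
    exact (integrable_const (0 : ℝ)).sup (hg.add (hf.integrable_comp_of_integrable ih))

/-- A consequence of the maximal ergodic theorem. -/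
theorem ae_bddAbove_birkhoffMax [IsProbabilityMeasure μ] (hf : Ergodic f μ)
    (hgm : Measurable g) (hg : Integrable g μ) (hneg : ∫ x, g x ∂μ < 0) :
    ∀ᵐ x ∂μ, BddAbove (Set.range fun n => birkhoffMax f g n x) := by
  have hmp := hf.toMeasurePreserving
  have hmeas : MeasurableSet {x | BddAbove (Set.range fun n => birkhoffMax f g n x)} :=
    measurableSet_bddAbove_range fun n => measurable_birkhoffMax hf.measurable hgm n
  have hinv : f ⁻¹' {x | BddAbove (Set.range fun n => birkhoffMax f g n x)}
      = {x | BddAbove (Set.range fun n => birkhoffMax f g n x)} := by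
    ext x
    exact bddAbove_range_birkhoffMax_comp f g x
  rcases hf.toPreErgodic.ae_mem_or_ae_notMem hmeas hinv with h | h
  · exact h
  exfalso
  -- If the maxima are unbounded, the integrand is eventually equal to `g x`; it is dominated by `|g
  -- x|` because the maxima are nonnegative.
  have hlim : Tendsto (fun n => ∫ x, max (-birkhoffMax f g n (f x)) (g x) ∂μ) atTop
      (𝓝 (∫ x, g x ∂μ)) := by
    refine tendsto_integral_of_dominated_convergence (fun x => |g x|) (fun n => ?_) hg.abs
      (fun n => ?_) ?_
    · exact (((measurable_birkhoffMax hf.measurable hgm n).comp hf.measurable).neg.max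
        hgm).aestronglyMeasurable
    · refine ae_of_all _ fun x => ?_
      have h0 := birkhoffMax_nonneg f g n (f x)
      rw [Real.norm_eq_abs, abs_le]
      refine ⟨(neg_abs_le _).trans (le_max_right _ _), max_le ?_ (le_abs_self _)⟩
      have := abs_nonneg (g x)
      linarith
    · filter_upwards [h] with x hx
      have hx' : ¬ BddAbove (Set.range fun n => birkhoffMax f g n (f x)) := by
        rwa [bddAbove_range_birkhoffMax_comp]
      have ht := tendsto_atTop_atTop_of_monotone' (birkhoffMax_mono f g (f x)) hx'
      refine tendsto_const_nhds.congr' ?_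
      filter_upwards [ht.eventually_ge_atTop (-g x)] with n hn
      rw [max_eq_right]
      linarith
  refine hneg.not_ge (ge_of_tendsto' hlim fun n => ?_)
  have h1 := integrable_birkhoffMax hmp hg (n + 1)
  have h2 := integrable_birkhoffMax hmp hg n
  have h3 : Integrable (fun x => birkhoffMax f g n (f x)) μ := hmp.integrable_comp_of_integrable h2
  have h4 : ∫ x, birkhoffMax f g n (f x) ∂μ = ∫ x, birkhoffMax f g n x ∂μ := by
    have := integral_map (μ := μ) hf.measurable.aemeasurable
      (f := birkhoffMax f g n) (measurable_birkhoffMax hf.measurable hgm n).aestronglyMeasurable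
    rw [hmp.map_eq] at this
    exact this.symm
  simp_rw [← birkhoffMax_succ_sub]
  rw [integral_sub h1 h3, h4, sub_nonneg]
  exact integral_mono h2 h1 fun x => birkhoffMax_le_succ f g n x

/-- One half of the pointwise ergodic theorem. -/
theorem ae_eventually_birkhoffSum_le [IsProbabilityMeasure μ] (hf : Ergodic f μ)
    (hgm : Measurable g) (hg : Integrable g μ) {c : ℝ} (hc : ∫ x, g x ∂μ < c) :
    ∀ᵐ x ∂μ, ∀ᶠ n : ℕ in atTop, birkhoffSum f g n x ≤ c * n := by
  -- The Birkhoff sums of `g - d` are bounded above, and the slack `(c - d) * n` absorbs the bound.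
  obtain ⟨d, hd1, hd2⟩ := exists_between hc
  have hneg : ∫ x, (g x - d) ∂μ < 0 := by
    rw [integral_sub hg (integrable_const d)]
    simpa using hd1
  filter_upwards [ae_bddAbove_birkhoffMax hf (hgm.sub_const d) (hg.sub (integrable_const d)) hneg]
    with x ⟨B, hB⟩
  have ht : Tendsto (fun n : ℕ => (c - d) * (n : ℝ)) atTop atTop :=
    tendsto_natCast_atTop_atTop.const_mul_atTop (sub_pos.2 hd2)
  filter_upwards [ht.eventually_ge_atTop B] with n hn
  have h1 := (birkhoffSum_le_birkhoffMax f (fun x => g x - d) n x).trans (hB ⟨n, rfl⟩)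
  have h2 : birkhoffSum f (fun x => g x - d) n x = birkhoffSum f g n x - n * d := by
    simp [birkhoffSum, Finset.sum_sub_distrib]
  rw [h2] at h1
  linarith

theorem ae_eventually_le_birkhoffSum [IsProbabilityMeasure μ] (hf : Ergodic f μ)
    (hgm : Measurable g) (hg : Integrable g μ) {c : ℝ} (hc : c < ∫ x, g x ∂μ) :
    ∀ᵐ x ∂μ, ∀ᶠ n : ℕ in atTop, c * n ≤ birkhoffSum f g n x := by
  have h : ∫ x, -g x ∂μ < -c := by
    rw [integral_neg]
    exact neg_lt_neg hc
  filter_upwards [ae_eventually_birkhoffSum_le hf hgm.neg hg.neg h] with x hx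
  filter_upwards [hx] with n hn
  have h2 : birkhoffSum f (fun x => -g x) n x = -birkhoffSum f g n x := by
    simp [birkhoffSum]
  change birkhoffSum f (fun x => -g x) n x ≤ _ at hn
  rw [h2] at hn
  linarith

end Birkhoff

/-! ### Markov properties and a zero-one law for i.i.d. sequences. -/

section Noise

variable {U : Type*}

/-- Forget the first `n` terms of a sequence. -/
def dropSeq (n : ℕ) (ω : ℕ → U) : ℕ → U := fun i => ω (n + i)

lemma dropSeq_apply (n i : ℕ) (ω : ℕ → U) : dropSeq n ω i = ω (n + i) := rfl

lemma dropSeq_dropSeq (m n : ℕ) (ω : ℕ → U) : dropSeq m (dropSeq n ω) = dropSeq (n + m) ω := by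
  funext i
  simp [dropSeq, add_assoc]

variable [MeasurableSpace U]

lemma measurable_dropSeq (n : ℕ) : Measurable (dropSeq n : (ℕ → U) → ℕ → U) :=
  measurable_pi_iff.2 fun _ => measurable_pi_apply _

variable (U) in
/-- The σ-algebra generated by the coordinates with index in `s`. -/
@[reducible]
def coordSigma (s : Set ℕ) : MeasurableSpace (ℕ → U) :=
  ⨆ i ∈ s, MeasurableSpace.comap (fun ω : ℕ → U => ω i) inferInstance

lemma coordSigma_le (s : Set ℕ) : coordSigma U s ≤ MeasurableSpace.pi :=
  iSup₂_le fun i _ => (measurable_pi_apply i).comap_le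

lemma measurable_coord {s : Set ℕ} {i : ℕ} (hi : i ∈ s) :
    Measurable[coordSigma U s] fun ω : ℕ → U => ω i :=
  Measurable.of_comap_le (le_iSup₂_of_le i hi le_rfl)

/-- `E` is its own preimage under the map that overwrites the coordinates outside `s` by a constant,
and that map is measurable for the smaller σ-algebra. -/
lemma measurableSet_coordSigma_of_dependsOn [Nonempty U] {s : Set ℕ} {E : Set (ℕ → U)}
    (hE : MeasurableSet E) (hdep : ∀ ω ω' : ℕ → U, (∀ i ∈ s, ω i = ω' i) → ω ∈ E → ω' ∈ E) :
    MeasurableSet[coordSigma U s] E := by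
  classical
  let u : U := Classical.arbitrary U
  let r : (ℕ → U) → ℕ → U := fun ω i => if i ∈ s then ω i else u
  have hr : Measurable[coordSigma U s] r := by
    refine @measurable_pi_lambda _ _ _ (coordSigma U s) _ _ fun i => ?_
    by_cases hi : i ∈ s
    · simpa [r, hi] using measurable_coord hi
    · simp [r, hi]
  have : E = r ⁻¹' E := by
    ext ω
    constructor
    · exact hdep ω (r ω) fun i hi => by simp [r, hi]
    · exact hdep (r ω) ω fun i hi => by simp [r, hi]
  rw [this]
  exact hr hE

variable (μ : Measure U) [IsProbabilityMeasure μ]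

/-- The law of an i.i.d. sequence. -/
noncomputable abbrev iidLaw : Measure (ℕ → U) := Measure.infinitePi fun _ : ℕ => μ

lemma measurePreserving_dropSeq (n : ℕ) : MeasurePreserving (dropSeq n) (iidLaw μ) (iidLaw μ) :=
  ⟨measurable_dropSeq n,
    Measure.map_infinitePi_infinitePi_of_inj (P := fun _ : ℕ => μ) (add_right_injective n)⟩

lemma indep_coordSigma {s t : Set ℕ} (hst : Disjoint s t) :
    Indep (coordSigma U s) (coordSigma U t) (iidLaw μ) := by
  have h : iIndepFun (fun (i : ℕ) (ω : ℕ → U) => ω i) (iidLaw μ) :=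
    iIndepFun_infinitePi (P := fun _ : ℕ => μ) (X := fun _ x => x) fun _ => measurable_id
  exact indep_iSup_of_disjoint (fun i => (measurable_pi_apply i).comap_le) h hst

/-- The simple Markov property of an i.i.d. sequence. -/
lemma iidLaw_inter_dropSeq [Nonempty U] (n : ℕ) {E A : Set (ℕ → U)}
    (hE : MeasurableSet[coordSigma U (Set.Iio n)] E) (hA : MeasurableSet A) :
    iidLaw μ (E ∩ dropSeq n ⁻¹' A) = iidLaw μ E * iidLaw μ A := by
  have hA' : MeasurableSet[coordSigma U (Set.Ici n)] (dropSeq n ⁻¹' A) := by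
    refine measurableSet_coordSigma_of_dependsOn (measurable_dropSeq n hA) fun ω ω' h hω => ?_
    have : dropSeq n ω = dropSeq n ω' := funext fun i => h _ (Nat.le_add_right n i)
    simpa [this] using hω
  have hd : Disjoint (Set.Iio n) (Set.Ici n) := by
    rw [Set.disjoint_left]
    intro i hi hi'
    exact absurd (Set.mem_Iio.1 hi) (not_lt.2 hi')
  rw [(Indep_iff _ _ _).1 (indep_coordSigma μ hd) E _ hE hA',
    (measurePreserving_dropSeq μ n).measure_preimage hA.nullMeasurableSet]

/-- The strong Markov property of an i.i.d. sequence; `E n` is the event that the stopping time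
has the value `n`. -/
lemma iidLaw_iUnion_inter_dropSeq [Nonempty U] {E : ℕ → Set (ℕ → U)}
    (hE : ∀ n, MeasurableSet[coordSigma U (Set.Iio n)] (E n)) (hd : Pairwise (Function.onFun Disjoint E))
    {A : Set (ℕ → U)} (hA : MeasurableSet A) :
    iidLaw μ (⋃ n, E n ∩ dropSeq n ⁻¹' A) = iidLaw μ (⋃ n, E n) * iidLaw μ A := by
  have hE' : ∀ n, MeasurableSet (E n) := fun n => coordSigma_le _ _ (hE n)
  rw [measure_iUnion (fun i j hij => (hd hij).mono Set.inter_subset_left Set.inter_subset_left)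
    fun n => (hE' n).inter (measurable_dropSeq n hA), measure_iUnion hd hE', ← ENNReal.tsum_mul_right]
  exact tsum_congr fun n => iidLaw_inter_dropSeq μ n (hE n) hA

lemma lintegral_indicator_mul_coord [Nonempty U] (n : ℕ) {E : Set (ℕ → U)}
    (hE : MeasurableSet[coordSigma U (Set.Iio n)] E) {g : U → ℝ≥0∞} (hg : Measurable g) :
    ∫⁻ ω, E.indicator (fun _ => 1) ω * g (ω n) ∂(iidLaw μ) = iidLaw μ E * ∫⁻ u, g u ∂μ := by
  have hd : Disjoint (Set.Iio n) {n} := by simp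
  have h1 : Measurable[coordSigma U (Set.Iio n)] (E.indicator fun _ => (1 : ℝ≥0∞)) :=
    Measurable.indicator measurable_const hE
  have h2 := lintegral_mul_eq_lintegral_mul_lintegral_of_independent_measurableSpace
    (coordSigma_le (Set.Iio n)) (coordSigma_le {n}) (indep_coordSigma μ hd) h1
    (hg.comp (measurable_coord (Set.mem_singleton n)))
  rw [lintegral_indicator_const (coordSigma_le _ _ hE), one_mul] at h2
  refine h2.trans ?_
  congr 1
  exact (measurePreserving_eval_infinitePi (fun _ : ℕ => μ) n).lintegral_comp hg

/-- Zero-one law: an event that is independent of each finite set of coordinates is trivial. -/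
lemma iidLaw_eq_zero_or_one [Nonempty U] {A : Set (ℕ → U)} (hA : MeasurableSet A)
    (h : ∀ n, ∀ B, MeasurableSet[coordSigma U (Set.Iio n)] B →
      iidLaw μ (A ∩ B) = iidLaw μ A * iidLaw μ B) :
    iidLaw μ A = 0 ∨ iidLaw μ A = 1 := by
  have hind : Indep (⨆ n, coordSigma U (Set.Iio n)) (MeasurableSpace.generateFrom {A})
      (iidLaw μ) := by
    refine indep_iSup_of_directed_le (fun n => ?_) (fun n => coordSigma_le _)
      (MeasurableSpace.generateFrom_le (by simpa using hA)) ?_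
    · refine IndepSets.indep (coordSigma_le _) (MeasurableSpace.generateFrom_le (by simpa using hA))
        (@MeasurableSpace.isPiSystem_measurableSet _ (coordSigma U (Set.Iio n)))
        (IsPiSystem.singleton A) (@MeasurableSpace.generateFrom_measurableSet _ (coordSigma U (Set.Iio n))).symm
        rfl ?_
      rw [IndepSets_iff]
      rintro B A' hB rfl
      rw [Set.inter_comm, h n B hB, mul_comm]
    · refine directed_of_isDirected_le fun m n hmn => ?_
      exact biSup_mono fun i hi => lt_of_lt_of_le hi hmn
  have hle : MeasurableSpace.pi ≤ ⨆ n, coordSigma U (Set.Iio n) := by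
    refine iSup_le fun i => ?_
    exact le_iSup_of_le (i + 1) (le_iSup₂_of_le i (Nat.lt_succ_self i) le_rfl)
  -- `A` is independent of itself, so its probability p satisfies p = p².
  have := (Indep_iff _ _ _).1 hind A A (hle _ hA)
    (MeasurableSpace.measurableSet_generateFrom (Set.mem_singleton A))
  rw [Set.inter_self] at this
  have hne : iidLaw μ A ≠ ∞ := measure_ne_top _ _
  by_cases h0 : iidLaw μ A = 0
  · exact Or.inl h0
  · right
    have h1 : iidLaw μ A * iidLaw μ A = iidLaw μ A * 1 := by rw [mul_one, ← this]
    exact (ENNReal.mul_right_inj h0 hne).1 h1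

end Noise

/-! ### Walks in an abstract stationary ergodic environment, and their reflection. -/

open scoped NNReal

/-- A nearest-neighbour walk on `ℤ` in a stationary ergodic environment `ξ ∈ Ω`, driven by
i.i.d. marks with law `μ`. At site `0` the walk jumps to the right when the mark lies in the
section `J_ξ`, and the rates to the right and to the left are `a ξ` and `b ξ`; the action `S`
moves a site to the origin, and the holding times have the clock `W`. -/
structure WalkSystem (Ω U : Type*) [MeasurableSpace Ω] [MeasurableSpace U] where
  P : Measure Ω
  [isProbP : IsProbabilityMeasure P]
  μ : Measure U
  [isProbμ : IsProbabilityMeasure μ]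
  S : ℤ → Ω → Ω
  S_zero : ∀ ξ, S 0 ξ = ξ
  S_add : ∀ x y ξ, S (x + y) ξ = S x (S y ξ)
  mp : ∀ x, MeasurePreserving (S x) P P
  erg : Ergodic (S 1) P
  J : Set (Ω × U)
  measurableSet_J : MeasurableSet J
  a : Ω → ℝ≥0
  b : Ω → ℝ≥0
  measurable_a : Measurable a
  measurable_b : Measurable b
  a_pos : ∀ ξ, 0 < a ξ
  b_pos : ∀ ξ, 0 < b ξ
  law : ∀ ξ, μ {u | (ξ, u) ∈ J} = (a ξ : ℝ≥0∞) / (a ξ + b ξ)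
  W : U → ℝ≥0
  measurable_W : Measurable W
  lintegral_W : ∫⁻ u, W u ∂μ = 1

namespace WalkSystem

variable {Ω U : Type*} [MeasurableSpace Ω] [MeasurableSpace U] (D : WalkSystem Ω U)

instance : IsProbabilityMeasure D.P := D.isProbP

instance : IsProbabilityMeasure D.μ := D.isProbμ

lemma nonempty_marks (D : WalkSystem Ω U) : Nonempty U := nonempty_of_isProbabilityMeasure D.μ

lemma S_neg_S (x : ℤ) (ξ : Ω) : D.S (-x) (D.S x ξ) = ξ := by
  rw [← D.S_add, neg_add_cancel, D.S_zero]

lemma ergodic_S_neg_one : Ergodic (D.S (-1)) D.P := by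
  refine ⟨D.mp (-1), ⟨fun s hs hinv => D.erg.toPreErgodic.aeconst_set hs ?_⟩⟩
  ext ξ
  have h := congrArg (fun t => D.S 1 ξ ∈ t) hinv
  simp only [Set.mem_preimage, D.S_neg_S, eq_iff_iff] at h
  exact h.symm

lemma law_compl (ξ : Ω) : D.μ {u | (ξ, u) ∈ D.Jᶜ} = (D.b ξ : ℝ≥0∞) / (D.b ξ + D.a ξ) := by
  have h : {u | (ξ, u) ∈ D.Jᶜ} = {u | (ξ, u) ∈ D.J}ᶜ := rfl
  have hm : MeasurableSet {u | (ξ, u) ∈ D.J} := measurable_prodMk_left D.measurableSet_J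
  have hne : (D.a ξ + D.b ξ : ℝ≥0∞) ≠ 0 := by
    simp [(D.a_pos ξ).ne']
  have hnt : (D.a ξ + D.b ξ : ℝ≥0∞) ≠ ∞ := by simp
  rw [h, prob_compl_eq_one_sub hm, D.law, add_comm (D.b ξ : ℝ≥0∞)]
  refine ENNReal.sub_eq_of_eq_add ?_ ?_
  · exact (ENNReal.div_lt_top (by simp) hne).ne
  · rw [← ENNReal.add_div, add_comm (D.b ξ : ℝ≥0∞), ENNReal.div_self hne hnt]

/-- The reflected system, in which left and right are exchanged. -/
def mirror : WalkSystem Ω U where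
  P := D.P
  μ := D.μ
  S x := D.S (-x)
  S_zero ξ := by simp [D.S_zero]
  S_add x y ξ := by rw [neg_add, D.S_add]
  mp x := D.mp (-x)
  erg := D.ergodic_S_neg_one
  J := D.Jᶜ
  measurableSet_J := D.measurableSet_J.compl
  a := D.b
  b := D.a
  measurable_a := D.measurable_b
  measurable_b := D.measurable_a
  a_pos := D.b_pos
  b_pos := D.a_pos
  law := D.law_compl
  W := D.W
  measurable_W := D.measurable_W
  lintegral_W := D.lintegral_W

/-- The law of the marks. -/
noncomputable abbrev ν : Measure (ℕ → U) := iidLaw D.μ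

/-- The joint (annealed) law of the environment and the marks. -/
noncomputable abbrev Q : Measure (Ω × (ℕ → U)) := D.P.prod D.ν

open scoped Classical in
/-- The increment of the walk at the origin. -/
noncomputable def step (q : Ω × U) : ℤ := if q ∈ D.J then 1 else -1

/-- The jump chain. -/
noncomputable def X (p : Ω × (ℕ → U)) : ℕ → ℤ
  | 0 => 0
  | n + 1 => X p n + D.step (D.S (X p n) p.1, p.2 n)

/-- The environment seen from the walk after `n` steps, with the remaining marks. -/
noncomputable def after (n : ℕ) (p : Ω × (ℕ → U)) : Ω × (ℕ → U) :=
  (D.S (D.X p n) p.1, dropSeq n p.2)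

/-- The holding time before the first jump. -/
noncomputable def hold (p : Ω × (ℕ → U)) : ℝ≥0 := D.W (p.2 0) / (D.a p.1 + D.b p.1)

/-- The time of the `n`-th jump. -/
noncomputable def clk (p : Ω × (ℕ → U)) (n : ℕ) : ℝ≥0 :=
  ∑ k ∈ Finset.range n, D.hold (D.after k p)

@[simp] lemma X_zero (p : Ω × (ℕ → U)) : D.X p 0 = 0 := rfl

lemma step_of_mem {q : Ω × U} (h : q ∈ D.J) : D.step q = 1 := if_pos h

lemma step_of_notMem {q : Ω × U} (h : q ∉ D.J) : D.step q = -1 := if_neg h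

lemma step_eq (q : Ω × U) : D.step q = 1 ∨ D.step q = -1 := by
  by_cases h : q ∈ D.J
  · exact Or.inl (D.step_of_mem h)
  · exact Or.inr (D.step_of_notMem h)

lemma measurable_step : Measurable D.step := by
  classical
  exact Measurable.ite D.measurableSet_J measurable_const measurable_const

lemma X_succ (p : Ω × (ℕ → U)) (n : ℕ) :
    D.X p (n + 1) = D.X p n + D.step (D.S (D.X p n) p.1, p.2 n) := rfl

lemma X_succ_of_mem {p : Ω × (ℕ → U)} {n : ℕ} (h : (D.S (D.X p n) p.1, p.2 n) ∈ D.J) :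
    D.X p (n + 1) = D.X p n + 1 := by
  rw [X_succ, D.step_of_mem h]

lemma X_succ_of_notMem {p : Ω × (ℕ → U)} {n : ℕ} (h : (D.S (D.X p n) p.1, p.2 n) ∉ D.J) :
    D.X p (n + 1) = D.X p n - 1 := by
  rw [X_succ, D.step_of_notMem h, sub_eq_add_neg]

lemma X_succ_le (p : Ω × (ℕ → U)) (n : ℕ) : D.X p (n + 1) ≤ D.X p n + 1 := by
  rw [X_succ]
  rcases D.step_eq (D.S (D.X p n) p.1, p.2 n) with h | h <;> omega

lemma le_X_succ (p : Ω × (ℕ → U)) (n : ℕ) : D.X p n - 1 ≤ D.X p (n + 1) := by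
  rw [X_succ]
  rcases D.step_eq (D.S (D.X p n) p.1, p.2 n) with h | h <;> omega

lemma X_le (p : Ω × (ℕ → U)) (n : ℕ) : D.X p n ≤ n := by
  induction n with
  | zero => simp
  | succ n ih =>
    have := D.X_succ_le p n
    push_cast
    omega

/-- Cocycle identity: the future of the chain is the same chain run in the translated environment
with the remaining marks. -/
lemma X_add (p : Ω × (ℕ → U)) (n m : ℕ) :
    D.X p (n + m) = D.X p n + D.X (D.after n p) m := by
  induction m with
  | zero => simp
  | succ m ih =>
    rw [← add_assoc, X_succ, X_succ, ih]
    simp only [after, dropSeq_apply, ← D.S_add]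
    rw [add_comm (D.X p n) (D.X _ m)]
    ring

@[simp] lemma after_zero (p : Ω × (ℕ → U)) : D.after 0 p = p := by
  simp only [after, X_zero, D.S_zero]
  ext i
  · rfl
  · simp [dropSeq]

lemma after_after (m n : ℕ) (p : Ω × (ℕ → U)) :
    D.after m (D.after n p) = D.after (n + m) p := by
  have h := D.X_add p n m
  simp only [after] at h ⊢
  rw [h, ← D.S_add, dropSeq_dropSeq, add_comm (D.X p n)]

lemma clk_zero (p : Ω × (ℕ → U)) : D.clk p 0 = 0 := by simp [clk]

lemma clk_add (p : Ω × (ℕ → U)) (n m : ℕ) :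
    D.clk p (n + m) = D.clk p n + D.clk (D.after n p) m := by
  simp only [clk, Finset.sum_range_add, after_after]

lemma clk_mono (p : Ω × (ℕ → U)) : Monotone (D.clk p) := fun n m h => by
  obtain ⟨k, rfl⟩ := Nat.exists_eq_add_of_le h
  rw [clk_add]
  exact le_self_add

lemma mirror_X (p : Ω × (ℕ → U)) (n : ℕ) : D.mirror.X p n = -D.X p n := by
  induction n with
  | zero => simp
  | succ n ih =>
    rw [X_succ, X_succ, ih]
    have h : D.mirror.S (-D.X p n) = D.S (D.X p n) := by
      show D.S (- -D.X p n) = _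
      rw [neg_neg]
    rw [h]
    by_cases hJ : (D.S (D.X p n) p.1, p.2 n) ∈ D.J
    · have : (D.S (D.X p n) p.1, p.2 n) ∉ D.mirror.J := fun h' => h' hJ
      rw [D.step_of_mem hJ, D.mirror.step_of_notMem this]
      ring
    · have : (D.S (D.X p n) p.1, p.2 n) ∈ D.mirror.J := hJ
      rw [D.step_of_notMem hJ, D.mirror.step_of_mem this]
      ring

lemma mirror_after (n : ℕ) (p : Ω × (ℕ → U)) : D.mirror.after n p = D.after n p := by
  simp only [after, mirror_X]
  show (D.S (- -D.X p n) p.1, _) = _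
  rw [neg_neg]

lemma mirror_clk (p : Ω × (ℕ → U)) : D.mirror.clk p = D.clk p := by
  funext n
  simp only [clk, mirror_after]
  refine Finset.sum_congr rfl fun k _ => ?_
  show D.W _ / (D.b _ + D.a _) = D.W _ / (D.a _ + D.b _)
  rw [add_comm]

lemma measurable_S (x : ℤ) : Measurable (D.S x) := (D.mp x).measurable

lemma measurable_uncurry_S : Measurable fun q : ℤ × Ω => D.S q.1 q.2 :=
  measurable_from_prod_countable_right fun x => D.measurable_S x

lemma measurable_X (n : ℕ) : Measurable fun p => D.X p n := by
  induction n with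
  | zero => exact measurable_const
  | succ n ih =>
    exact ih.add (D.measurable_step.comp ((D.measurable_uncurry_S.comp
      (ih.prodMk measurable_fst)).prodMk ((measurable_pi_apply n).comp measurable_snd)))

lemma measurable_after (n : ℕ) : Measurable (D.after n) :=
  (D.measurable_uncurry_S.comp ((D.measurable_X n).prodMk measurable_fst)).prodMk
    ((measurable_dropSeq n).comp measurable_snd)

lemma measurable_hold : Measurable D.hold :=
  (D.measurable_W.comp ((measurable_pi_apply 0).comp measurable_snd)).div
    ((D.measurable_a.comp measurable_fst).add (D.measurable_b.comp measurable_fst))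

lemma measurable_clk (n : ℕ) : Measurable fun p => D.clk p n :=
  Finset.measurable_sum _ fun k _ => D.measurable_hold.comp (D.measurable_after k)

lemma X_congr (ξ : Ω) {ω ω' : ℕ → U} {n : ℕ} (h : ∀ i ∈ Set.Iio n, ω i = ω' i) :
    ∀ m ≤ n, D.X (ξ, ω) m = D.X (ξ, ω') m := by
  intro m hm
  induction m with
  | zero => rfl
  | succ m ih =>
    rw [X_succ, X_succ, ih (by omega)]
    simp only
    rw [h m (Set.mem_Iio.2 (by omega))]

lemma measurable_section {T : Set (Ω × (ℕ → U))} (hT : MeasurableSet T) (ξ : Ω) :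
    MeasurableSet {ω | (ξ, ω) ∈ T} :=
  measurable_prodMk_left hT

lemma measurable_prob {T : Set (Ω × (ℕ → U))} (hT : MeasurableSet T) :
    Measurable fun ξ => D.ν {ω | (ξ, ω) ∈ T} :=
  measurable_measure_prodMk_left hT

lemma Q_eq {T : Set (Ω × (ℕ → U))} (hT : MeasurableSet T) :
    D.Q T = ∫⁻ ξ, D.ν {ω | (ξ, ω) ∈ T} ∂D.P :=
  Measure.prod_apply hT

lemma ae_Q_iff {T : Set (Ω × (ℕ → U))} (hT : MeasurableSet T) :
    (∀ᵐ p ∂D.Q, p ∈ T) ↔ ∀ᵐ ξ ∂D.P, ∀ᵐ ω ∂D.ν, (ξ, ω) ∈ T :=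
  Measure.ae_prod_iff_ae_ae hT

end WalkSystem

/-! ### First visits to levels, the strong Markov property and ergodicity of `Φ 1`. -/

namespace WalkSystem

variable {Ω U : Type*} [MeasurableSpace Ω] [MeasurableSpace U] (D : WalkSystem Ω U)

/-- The event that the walk reaches level `k`. -/
def hit (k : ℕ) : Set (Ω × (ℕ → U)) := {p | ∃ n, (k : ℤ) ≤ D.X p n}

/-- The event that the walk is unbounded above. -/
def unb : Set (Ω × (ℕ → U)) := {p | ∀ k, p ∈ D.hit k}

/-- The event that the walk reaches level `k` for the first time at step `n`. -/
def first (k n : ℕ) : Set (Ω × (ℕ → U)) := {p | D.X p n = k ∧ ∀ m < n, D.X p m < k}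

/-- The step at which the walk first reaches level `k` (`0` if there is none). -/
noncomputable def N (k : ℕ) (p : Ω × (ℕ → U)) : ℕ := sInf {n | (k : ℤ) ≤ D.X p n}

/-- The environment seen from the walk when it first reaches level `k`. -/
noncomputable def Φ (k : ℕ) (p : Ω × (ℕ → U)) : Ω × (ℕ → U) := D.after (D.N k p) p

variable {D}

lemma first_N {k : ℕ} {p : Ω × (ℕ → U)} (h : p ∈ D.hit k) : p ∈ D.first k (D.N k p) := by
  have h1 : (k : ℤ) ≤ D.X p (D.N k p) := Nat.sInf_mem (s := {n | (k : ℤ) ≤ D.X p n}) h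
  have h2 : ∀ m < D.N k p, D.X p m < k := fun m hm => not_le.1 (Nat.notMem_of_lt_sInf hm)
  refine ⟨le_antisymm ?_ h1, h2⟩
  rcases hn : D.N k p with _ | n
  · simp
  · have := h2 n (by omega)
    have := D.X_succ_le p n
    omega

lemma N_eq {k n : ℕ} {p : Ω × (ℕ → U)} (h : p ∈ D.first k n) : D.N k p = n := by
  refine le_antisymm (Nat.sInf_le h.1.ge) (not_lt.1 fun hlt => ?_)
  have h1 : (k : ℤ) ≤ D.X p (D.N k p) := Nat.sInf_mem (s := {n | (k : ℤ) ≤ D.X p n}) ⟨n, h.1.ge⟩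
  exact absurd (h.2 _ hlt) (not_lt.2 h1)

lemma hit_of_first {k n : ℕ} {p : Ω × (ℕ → U)} (h : p ∈ D.first k n) : p ∈ D.hit k :=
  ⟨n, h.1.ge⟩

variable (D) in
lemma hit_eq_iUnion (k : ℕ) : D.hit k = ⋃ n, D.first k n := by
  ext p
  simp only [Set.mem_iUnion]
  exact ⟨fun h => ⟨_, first_N h⟩, fun ⟨n, h⟩ => hit_of_first h⟩

variable (D) in
lemma hit_anti {k l : ℕ} (h : k ≤ l) : D.hit l ⊆ D.hit k := fun _ ⟨n, hn⟩ =>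
  ⟨n, le_trans (by exact_mod_cast h) hn⟩

lemma X_first_add {k n : ℕ} {p : Ω × (ℕ → U)} (h : p ∈ D.first k n) (m : ℕ) :
    D.X p (n + m) = k + D.X (D.after n p) m := by
  rw [D.X_add, h.1]

lemma first_add {k l n m : ℕ} {p : Ω × (ℕ → U)} (h : p ∈ D.first k n)
    (h' : D.after n p ∈ D.first l m) : p ∈ D.first (k + l) (n + m) := by
  refine ⟨by rw [X_first_add h, h'.1]; push_cast; rfl, fun i hi => ?_⟩
  rcases lt_or_ge i n with hin | hin
  · have := h.2 i hin
    push_cast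
    omega
  · obtain ⟨j, rfl⟩ := Nat.exists_eq_add_of_le hin
    have := h'.2 j (by omega)
    rw [X_first_add h]
    push_cast
    omega

lemma hit_add_iff {k l n : ℕ} {p : Ω × (ℕ → U)} (h : p ∈ D.first k n) :
    p ∈ D.hit (k + l) ↔ D.after n p ∈ D.hit l := by
  constructor
  · rintro ⟨i, hi⟩
    push_cast at hi
    rcases lt_or_ge i n with hin | hin
    · have := h.2 i hin
      omega
    · obtain ⟨j, rfl⟩ := Nat.exists_eq_add_of_le hin
      rw [X_first_add h] at hi
      exact ⟨j, by omega⟩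
  · rintro ⟨j, hj⟩
    refine ⟨n + j, ?_⟩
    rw [X_first_add h]
    push_cast
    omega

lemma Φ_eq {k n : ℕ} {p : Ω × (ℕ → U)} (h : p ∈ D.first k n) : D.Φ k p = D.after n p := by
  rw [Φ, N_eq h]

lemma Φ_fst {k : ℕ} {p : Ω × (ℕ → U)} (h : p ∈ D.hit k) : (D.Φ k p).1 = D.S k p.1 := by
  show D.S (D.X p (D.N k p)) p.1 = _
  rw [(first_N h).1]

lemma N_add {k l : ℕ} {p : Ω × (ℕ → U)} (h : p ∈ D.hit (k + l)) :
    D.N (k + l) p = D.N k p + D.N l (D.Φ k p) := by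
  have hk := first_N (D.hit_anti (Nat.le_add_right k l) h)
  have hl := first_N ((hit_add_iff hk).1 h)
  exact N_eq (first_add hk hl)

lemma Φ_Φ {k l : ℕ} {p : Ω × (ℕ → U)} (h : p ∈ D.hit (k + l)) :
    D.Φ l (D.Φ k p) = D.Φ (k + l) p := by
  rw [Φ, Φ, D.after_after, Φ, N_add h]
  rfl

lemma Φ_mem_hit_iff {k l : ℕ} {p : Ω × (ℕ → U)} (h : p ∈ D.hit k) :
    D.Φ k p ∈ D.hit l ↔ p ∈ D.hit (k + l) :=
  (hit_add_iff (first_N h)).symm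

lemma Φ_mem_unb_iff {k : ℕ} {p : Ω × (ℕ → U)} (h : p ∈ D.hit k) :
    D.Φ k p ∈ D.unb ↔ p ∈ D.unb := by
  constructor
  · intro h' l
    exact D.hit_anti (Nat.le_add_left l k) ((Φ_mem_hit_iff h).1 (h' l))
  · intro h' l
    exact (Φ_mem_hit_iff h).2 (h' (k + l))

variable (D) in
lemma N_zero (p : Ω × (ℕ → U)) : D.N 0 p = 0 := N_eq ⟨by simp, by simp⟩

variable (D) in
lemma Φ_zero (p : Ω × (ℕ → U)) : D.Φ 0 p = p := by
  rw [Φ, N_zero, after_zero]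

/-- Successive levels are governed by one map, so that ergodic theory applies to hitting times. -/
lemma iterate_Φ {p : Ω × (ℕ → U)} (h : p ∈ D.unb) (k : ℕ) : (D.Φ 1)^[k] p = D.Φ k p := by
  induction k with
  | zero => rw [Φ_zero]; rfl
  | succ k ih => rw [Function.iterate_succ_apply', ih, Φ_Φ (h _)]

lemma le_N {k : ℕ} {p : Ω × (ℕ → U)} (h : p ∈ D.hit k) : k ≤ D.N k p := by
  have h1 := (first_N h).1
  have h2 := D.X_le p (D.N k p)
  omega

variable (D)

lemma measurableSet_hit (k : ℕ) : MeasurableSet (D.hit k) := by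
  have : D.hit k = ⋃ n, {p | (k : ℤ) ≤ D.X p n} := by
    ext p
    simp [hit]
  rw [this]
  exact MeasurableSet.iUnion fun n => measurableSet_le measurable_const (D.measurable_X n)

lemma measurableSet_first (k n : ℕ) : MeasurableSet (D.first k n) := by
  have : D.first k n = {p | D.X p n = k} ∩ ⋂ m ∈ Set.Iio n, {p | D.X p m < k} := by
    ext p
    simp [first]
  rw [this]
  exact (measurableSet_eq_fun (D.measurable_X n) measurable_const).inter
    (MeasurableSet.biInter (Set.to_countable _) fun m _ =>
      measurableSet_lt (D.measurable_X m) measurable_const)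

lemma measurableSet_unb : MeasurableSet D.unb := by
  have : D.unb = ⋂ k, D.hit k := by
    ext p
    simp [unb]
  rw [this]
  exact MeasurableSet.iInter D.measurableSet_hit

lemma measurable_N (k : ℕ) : Measurable (D.N k) := by
  refine measurable_to_countable' fun n => ?_
  have h : ∀ p, p ∉ D.hit k → D.N k p = 0 := fun p hp => by
    rw [N, Nat.sInf_eq_zero]
    exact Or.inr (Set.eq_empty_of_forall_notMem fun n hn => hp ⟨n, hn⟩)
  rcases eq_or_ne n 0 with rfl | hn
  · have : D.N k ⁻¹' {0} = D.first k 0 ∪ (D.hit k)ᶜ := by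
      ext p
      constructor
      · intro hp
        by_cases hh : p ∈ D.hit k
        · have := first_N hh
          rw [show D.N k p = 0 from hp] at this
          exact Or.inl this
        · exact Or.inr hh
      · rintro (hp | hp)
        · exact N_eq hp
        · exact h p hp
    rw [this]
    exact (D.measurableSet_first k 0).union (D.measurableSet_hit k).compl
  · have : D.N k ⁻¹' {n} = D.first k n := by
      ext p
      constructor
      · intro hp
        by_cases hh : p ∈ D.hit k
        · have := first_N hh
          rwa [show D.N k p = n from hp] at this
        · exact absurd ((show D.N k p = n from hp).symm.trans (h p hh)) hn
      · exact fun hp => N_eq hp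
    rw [this]
    exact D.measurableSet_first k n

lemma measurable_Φ (k : ℕ) : Measurable (D.Φ k) := by
  have h : Measurable fun q : ℕ × (Ω × (ℕ → U)) => D.after q.1 q.2 :=
    measurable_from_prod_countable_right D.measurable_after
  exact h.comp ((D.measurable_N k).prodMk measurable_id)

lemma measurableSet_first_section (ξ : Ω) (k n : ℕ) :
    MeasurableSet[coordSigma U (Set.Iio n)] {ω | (ξ, ω) ∈ D.first k n} := by
  have := D.nonempty_marks
  refine measurableSet_coordSigma_of_dependsOn (measurable_section (D.measurableSet_first k n) ξ)
    fun ω ω' h hω => ?_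
  have hX := D.X_congr ξ h
  exact ⟨(hX n le_rfl).symm.trans hω.1, fun m hm => (hX m hm.le).symm.trans_lt (hω.2 m hm)⟩

lemma disjoint_first {k n m : ℕ} (h : n ≠ m) : Disjoint (D.first k n) (D.first k m) := by
  rw [Set.disjoint_left]
  intro p hn hm
  exact h ((N_eq hn).symm.trans (N_eq hm))

/-- The strong Markov property at the first visit to level `k`. -/
lemma strong_markov (ξ : Ω) (k : ℕ) {B : Set (ℕ → U)}
    (hB : MeasurableSet[coordSigma U (Set.Iio k)] B) {C : Set (Ω × (ℕ → U))}
    (hC : MeasurableSet C) :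
    D.ν (B ∩ {ω | (ξ, ω) ∈ D.hit k ∧ D.Φ k (ξ, ω) ∈ C})
      = D.ν (B ∩ {ω | (ξ, ω) ∈ D.hit k}) * D.ν {ω | (D.S k ξ, ω) ∈ C} := by
  have := D.nonempty_marks
  let E : ℕ → Set (ℕ → U) := fun n => B ∩ {ω | (ξ, ω) ∈ D.first k n}
  have hE : ∀ n, MeasurableSet[coordSigma U (Set.Iio n)] (E n) := fun n => by
    -- Level `k` cannot be reached in fewer than `k` steps. Hence `B`, known from the first `k`
    -- marks, is already decided at the hitting step.
    rcases lt_or_ge n k with hn | hn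
    · have : E n = ∅ := by
        refine Set.eq_empty_of_forall_notMem fun ω hω => ?_
        have h1 := hω.2.1
        have h2 := D.X_le (ξ, ω) n
        omega
      rw [this]
      exact @MeasurableSet.empty _ (coordSigma U (Set.Iio n))
    · have hle : coordSigma U (Set.Iio k) ≤ coordSigma U (Set.Iio n) :=
        biSup_mono fun i hi => lt_of_lt_of_le hi hn
      exact @MeasurableSet.inter _ (coordSigma U (Set.Iio n)) _ _ (hle _ hB)
        (D.measurableSet_first_section ξ k n)
  have hd : Pairwise (Function.onFun Disjoint E) := fun n m hnm => by
    rw [Function.onFun, Set.disjoint_left]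
    intro ω h1 h2
    exact Set.disjoint_left.1 (D.disjoint_first hnm) h1.2 h2.2
  have h := iidLaw_iUnion_inter_dropSeq D.μ hE hd (measurable_section hC (D.S k ξ))
  have e1 : ⋃ n, E n = B ∩ {ω | (ξ, ω) ∈ D.hit k} := by
    ext ω
    rw [D.hit_eq_iUnion]
    simp [E]
  have e2 : ⋃ n, E n ∩ dropSeq n ⁻¹' {ω | (D.S k ξ, ω) ∈ C}
      = B ∩ {ω | (ξ, ω) ∈ D.hit k ∧ D.Φ k (ξ, ω) ∈ C} := by
    ext ω
    simp only [Set.mem_iUnion]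
    have key : ∀ n, (ξ, ω) ∈ D.first k n → D.Φ k (ξ, ω) = (D.S k ξ, dropSeq n ω) := fun n hn => by
      rw [Φ_eq hn, after, hn.1]
    constructor
    · rintro ⟨n, ⟨hb, hn⟩, hc⟩
      refine ⟨hb, hit_of_first hn, ?_⟩
      rw [key n hn]
      exact hc
    · rintro ⟨hb, hh, hc⟩
      refine ⟨D.N k (ξ, ω), ⟨hb, first_N hh⟩, ?_⟩
      rw [key _ (first_N hh)] at hc
      exact hc
  rw [e1, e2] at h
  exact h

lemma strong_markov_hit (ξ : Ω) (k : ℕ) {C : Set (Ω × (ℕ → U))} (hC : MeasurableSet C) :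
    D.ν {ω | (ξ, ω) ∈ D.hit k ∧ D.Φ k (ξ, ω) ∈ C}
      = D.ν {ω | (ξ, ω) ∈ D.hit k} * D.ν {ω | (D.S k ξ, ω) ∈ C} := by
  have := D.strong_markov ξ k (@MeasurableSet.univ _ (coordSigma U (Set.Iio k))) hC
  simpa using this

/-- Let f be the quenched probability of being unbounded above. The strong Markov property gives f =
P(hit 1) · f∘S ≤ f∘S; stationarity forces equality and ergodicity makes f constant. A nonzero
constant cancels, leaving P(hit 1) = 1. -/
lemma hit_one_ae_of_not_ae_bounded (h : ¬ ∀ᵐ p ∂D.Q, p ∉ D.unb) :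
    ∀ᵐ ξ ∂D.P, D.ν {ω | (ξ, ω) ∈ D.hit 1} = 1 := by
  let f : Ω → ℝ≥0∞ := fun ξ => D.ν {ω | (ξ, ω) ∈ D.unb}
  have hf : Measurable f := D.measurable_prob D.measurableSet_unb
  have hrec : ∀ ξ, f ξ = D.ν {ω | (ξ, ω) ∈ D.hit 1} * f (D.S 1 ξ) := fun ξ => by
    have := D.strong_markov_hit ξ 1 D.measurableSet_unb
    rw [Nat.cast_one] at this
    rw [← this]
    refine congrArg D.ν (Set.ext fun ω => ?_)
    exact ⟨fun hω => ⟨hω 1, (Φ_mem_unb_iff (hω 1)).2 hω⟩, fun hω => (Φ_mem_unb_iff hω.1).1 hω.2⟩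
  have hle : ∀ ξ, f ξ ≤ f (D.S 1 ξ) := fun ξ => by
    rw [hrec ξ]
    exact mul_le_of_le_one_left' prob_le_one
  have hint : ∫⁻ ξ, f (D.S 1 ξ) ∂D.P = ∫⁻ ξ, f ξ ∂D.P := (D.mp 1).lintegral_comp hf
  have hlt : ∫⁻ ξ, f ξ ∂D.P ≠ ∞ := by
    have : ∫⁻ ξ, f ξ ∂D.P ≤ ∫⁻ _, 1 ∂D.P := lintegral_mono fun ξ => prob_le_one
    rw [lintegral_one, measure_univ] at this
    exact (this.trans_lt ENNReal.one_lt_top).ne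
  have heq : f =ᵐ[D.P] f ∘ D.S 1 :=
    ae_eq_of_ae_le_of_lintegral_le (ae_of_all _ hle) hlt (hf.comp (D.measurable_S 1)).aemeasurable
      hint.le
  obtain ⟨c, hc⟩ := D.erg.ae_eq_const_of_ae_eq_comp₀ hf.nullMeasurable heq.symm
  have hc0 : c ≠ 0 := by
    rintro rfl
    refine h ((D.ae_Q_iff D.measurableSet_unb.compl).2 ?_)
    filter_upwards [hc] with ξ hξ
    exact measure_eq_zero_iff_ae_notMem.1 hξ
  filter_upwards [hc, heq] with ξ h1 h2
  have h3 := hrec ξ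
  have h4 : f (D.S 1 ξ) = c := h2.symm.trans h1
  rw [h4, show f ξ = c from h1] at h3
  have hcT : c ≠ ∞ := by
    rw [← show f ξ = c from h1]
    exact measure_ne_top _ _
  have h5 : 1 * c = D.ν {ω | (ξ, ω) ∈ D.hit 1} * c := by rw [one_mul]; exact h3
  exact ((ENNReal.mul_left_inj hc0 hcT).1 h5).symm

/-- By stationarity the hypothesis also holds for the translated environments, so the levels are
climbed one by one. -/
lemma unb_ae_of_hit_one (h : ∀ᵐ ξ ∂D.P, D.ν {ω | (ξ, ω) ∈ D.hit 1} = 1) :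
    ∀ᵐ p ∂D.Q, p ∈ D.unb := by
  have hk : ∀ k, ∀ᵐ ξ ∂D.P, D.ν {ω | (ξ, ω) ∈ D.hit k} = 1 := by
    intro k
    induction k with
    | zero =>
      refine ae_of_all _ fun ξ => ?_
      have : {ω | (ξ, ω) ∈ D.hit 0} = Set.univ := Set.eq_univ_of_forall fun ω => ⟨0, by simp⟩
      rw [this, measure_univ]
    | succ k ih =>
      filter_upwards [h, (D.mp 1).quasiMeasurePreserving.ae ih] with ξ h1 h2
      have h3 := D.strong_markov_hit ξ 1 (D.measurableSet_hit k)
      rw [Nat.cast_one, h1, h2, one_mul] at h3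
      rw [← h3]
      refine congrArg D.ν (Set.ext fun ω => ?_)
      have hadd : k + 1 = 1 + k := add_comm _ _
      constructor
      · intro hω
        have h1 := D.hit_anti (Nat.le_add_left 1 k) hω
        exact ⟨h1, (Φ_mem_hit_iff h1).2 (hadd ▸ hω)⟩
      · intro hω
        exact hadd ▸ (Φ_mem_hit_iff hω.1).1 hω.2
  refine ae_all_iff.2 fun k => (D.ae_Q_iff (D.measurableSet_hit k)).2 ?_
  filter_upwards [hk k] with ξ hξ
  exact (mem_ae_iff_prob_eq_one (measurable_section (D.measurableSet_hit k) ξ)).2 hξ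

lemma unb_ae_or_bounded_ae : (∀ᵐ p ∂D.Q, p ∈ D.unb) ∨ ∀ᵐ p ∂D.Q, p ∉ D.unb := by
  by_cases h : ∀ᵐ p ∂D.Q, p ∉ D.unb
  · exact Or.inr h
  · exact Or.inl (D.unb_ae_of_hit_one (D.hit_one_ae_of_not_ae_bounded h))

variable {D}

lemma ae_hit_of_unb (h : ∀ᵐ p ∂D.Q, p ∈ D.unb) (k : ℕ) :
    ∀ᵐ ξ ∂D.P, ∀ᵐ ω ∂D.ν, (ξ, ω) ∈ D.hit k := by
  filter_upwards [(D.ae_Q_iff D.measurableSet_unb).1 h] with ξ hξ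
  filter_upwards [hξ] with ω hω using hω k

/-- If the walk reaches level `k`, it starts afresh from there. -/
lemma strong_markov_of_ae_hit {ξ : Ω} {k : ℕ} (h : ∀ᵐ ω ∂D.ν, (ξ, ω) ∈ D.hit k)
    {B : Set (ℕ → U)} (hB : MeasurableSet[coordSigma U (Set.Iio k)] B)
    {C : Set (Ω × (ℕ → U))} (hC : MeasurableSet C) :
    D.ν (B ∩ {ω | D.Φ k (ξ, ω) ∈ C}) = D.ν B * D.ν {ω | (D.S k ξ, ω) ∈ C} := by
  have h1 := D.strong_markov ξ k hB hC
  have e1 : D.ν (B ∩ {ω | (ξ, ω) ∈ D.hit k ∧ D.Φ k (ξ, ω) ∈ C})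
      = D.ν (B ∩ {ω | D.Φ k (ξ, ω) ∈ C}) := by
    refine measure_congr ?_
    filter_upwards [h] with ω hω
    exact propext ⟨fun ⟨hb, _, hc⟩ => ⟨hb, hc⟩, fun ⟨hb, hc⟩ => ⟨hb, hω, hc⟩⟩
  have e2 : D.ν (B ∩ {ω | (ξ, ω) ∈ D.hit k}) = D.ν B := by
    refine measure_congr ?_
    filter_upwards [h] with ω hω
    exact propext ⟨fun hb => hb.1, fun hb => ⟨hb, hω⟩⟩
  rwa [e1, e2] at h1

/-- The environment moves by `S 1`, which preserves `P`, and the marks left over after the visit are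
fresh. -/
lemma measurePreserving_Φ (h : ∀ᵐ p ∂D.Q, p ∈ D.unb) : MeasurePreserving (D.Φ 1) D.Q D.Q := by
  refine ⟨D.measurable_Φ 1, Measure.ext fun C hC => ?_⟩
  rw [Measure.map_apply (D.measurable_Φ 1) hC, D.Q_eq (D.measurable_Φ 1 hC), D.Q_eq hC,
    ← (D.mp 1).lintegral_comp (D.measurable_prob hC)]
  refine lintegral_congr_ae ?_
  filter_upwards [ae_hit_of_unb h 1] with ξ hξ
  have h1 := strong_markov_of_ae_hit hξ (@MeasurableSet.univ _ (coordSigma U (Set.Iio 1))) hC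
  rw [Set.univ_inter, measure_univ, one_mul, Nat.cast_one] at h1
  exact h1

/-- For an invariant `A`, membership can be read off at level k, whose visit comes after at least k
steps. So each section of `A` is independent of the first k marks for every k and has probability 0
or 1; ergodicity of the environment makes this value constant. -/
lemma ergodic_Φ (h : ∀ᵐ p ∂D.Q, p ∈ D.unb) : Ergodic (D.Φ 1) D.Q := by
  have := D.nonempty_marks
  refine ⟨measurePreserving_Φ h, ⟨fun A hA hinv => ?_⟩⟩
  have hAk : ∀ k, (D.Φ 1)^[k] ⁻¹' A = A := fun k => by
    induction k with
    | zero => rfl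
    | succ k ih => rw [Function.iterate_succ, Set.preimage_comp, ih, hinv]
  let c : Ω → ℝ≥0∞ := fun ξ => D.ν {ω | (ξ, ω) ∈ A}
  have hcm : Measurable c := D.measurable_prob hA
  have hmarkov : ∀ k, ∀ᵐ ξ ∂D.P, ∀ B, MeasurableSet[coordSigma U (Set.Iio k)] B →
      D.ν (B ∩ {ω | (ξ, ω) ∈ A}) = D.ν B * c (D.S k ξ) := fun k => by
    filter_upwards [(D.ae_Q_iff D.measurableSet_unb).1 h] with ξ hξ B hB
    have h1 := strong_markov_of_ae_hit (hξ.mono fun ω hω => hω k) hB hA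
    rw [← h1]
    refine measure_congr ?_
    filter_upwards [hξ] with ω hω
    have h2 : (ξ, ω) ∈ A ↔ D.Φ k (ξ, ω) ∈ A := by
      conv_lhs => rw [← hAk k]
      rw [Set.mem_preimage, iterate_Φ hω]
    exact propext ⟨fun ⟨hb, ha⟩ => ⟨hb, h2.1 ha⟩, fun ⟨hb, ha⟩ => ⟨hb, h2.2 ha⟩⟩
  have hck : ∀ k : ℕ, ∀ᵐ ξ ∂D.P, c ξ = c (D.S k ξ) := fun k => by
    filter_upwards [hmarkov k] with ξ hξ
    have := hξ Set.univ (@MeasurableSet.univ _ (coordSigma U (Set.Iio k)))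
    rwa [Set.univ_inter, measure_univ, one_mul] at this
  have h01 : ∀ᵐ ξ ∂D.P, c ξ = 0 ∨ c ξ = 1 := by
    filter_upwards [ae_all_iff.2 hmarkov, ae_all_iff.2 hck] with ξ h1 h2
    refine iidLaw_eq_zero_or_one D.μ (measurable_section hA ξ) fun n B hB => ?_
    rw [Set.inter_comm, h1 n B hB, ← h2 n, mul_comm]
  obtain ⟨d, hd⟩ := D.erg.ae_eq_const_of_ae_eq_comp₀ hcm.nullMeasurable
    ((hck 1).mono fun ξ hξ => by
      rw [Nat.cast_one] at hξ
      exact hξ.symm)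
  have hd01 : d = 0 ∨ d = 1 := by
    obtain ⟨ξ, h1, h2⟩ := (hd.and h01).exists
    rwa [show c ξ = d from h1] at h2
  rw [eventuallyConst_set]
  rcases hd01 with rfl | rfl
  · right
    refine ((D.ae_Q_iff hA.compl).2 (hd.mono fun ξ hξ => measure_eq_zero_iff_ae_notMem.1 hξ)).mono
      fun p hp => hp
  · left
    exact (D.ae_Q_iff hA).2 (hd.mono fun ξ hξ =>
      (mem_ae_iff_prob_eq_one (measurable_section hA ξ)).2 hξ)

end WalkSystem

/-! ### Expected occupation times before the first visit to level 1. -/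

namespace WalkSystem

variable {Ω U : Type*} [MeasurableSpace Ω] [MeasurableSpace U] (D : WalkSystem Ω U)

/-- The event that the walk stays in `(-∞, 0]` during the first `n` steps. -/
def alive (n : ℕ) : Set (Ω × (ℕ → U)) := {p | ∀ m ≤ n, D.X p m ≤ 0}

/-- The event that the walk is at `-i` at step `n`, and has not been positive before. -/
def visit (i n : ℕ) : Set (Ω × (ℕ → U)) := D.alive n ∩ {p | D.X p n = -(i : ℤ)}

/-- The event that the walk is to the left of `-i` at step `n`, and has not been positive before. -/
def below (i n : ℕ) : Set (Ω × (ℕ → U)) := D.alive n ∩ {p | D.X p n < -(i : ℤ)}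

/-- The part of `visit i n` in which the walk makes its next step to the right. -/
def goRight (i n : ℕ) : Set (Ω × (ℕ → U)) :=
  D.visit i n ∩ {p | (D.S (-(i : ℤ)) p.1, p.2 n) ∈ D.J}

/-- The part of `visit i n` in which the walk makes its next step to the left. -/
def goLeft (i n : ℕ) : Set (Ω × (ℕ → U)) :=
  D.visit i n ∩ {p | (D.S (-(i : ℤ)) p.1, p.2 n) ∉ D.J}

lemma measurableSet_alive (n : ℕ) : MeasurableSet (D.alive n) := by
  have : D.alive n = ⋂ m ∈ Set.Iic n, {p | D.X p m ≤ 0} := by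
    ext p
    simp [alive]
  rw [this]
  exact MeasurableSet.biInter (Set.to_countable _) fun m _ =>
    measurableSet_le (D.measurable_X m) measurable_const

lemma measurableSet_visit (i n : ℕ) : MeasurableSet (D.visit i n) :=
  (D.measurableSet_alive n).inter (measurableSet_eq_fun (D.measurable_X n) measurable_const)

lemma measurable_site_mark (i n : ℕ) :
    Measurable fun p : Ω × (ℕ → U) => (D.S (-(i : ℤ)) p.1, p.2 n) :=
  ((D.measurable_S _).comp measurable_fst).prodMk ((measurable_pi_apply n).comp measurable_snd)

lemma measurableSet_goRight (i n : ℕ) : MeasurableSet (D.goRight i n) :=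
  (D.measurableSet_visit i n).inter (D.measurable_site_mark i n D.measurableSet_J)

lemma measurableSet_goLeft (i n : ℕ) : MeasurableSet (D.goLeft i n) :=
  (D.measurableSet_visit i n).inter (D.measurable_site_mark i n D.measurableSet_J.compl)

lemma measurableSet_visit_section (ξ : Ω) (i n : ℕ) :
    MeasurableSet[coordSigma U (Set.Iio n)] {ω | (ξ, ω) ∈ D.visit i n} := by
  have := D.nonempty_marks
  refine measurableSet_coordSigma_of_dependsOn (measurable_section (D.measurableSet_visit i n) ξ)
    fun ω ω' h hω => ?_
  have hX := D.X_congr ξ h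
  exact ⟨fun m hm => (hX m hm).symm.trans_le (hω.1 m hm), (hX n le_rfl).symm.trans hω.2⟩

lemma prob_visit_inter_mark (ξ : Ω) (i n : ℕ) {V : Set U} (hV : MeasurableSet V) :
    D.ν ({ω | (ξ, ω) ∈ D.visit i n} ∩ {ω | ω n ∈ V})
      = D.ν {ω | (ξ, ω) ∈ D.visit i n} * D.μ V := by
  have := D.nonempty_marks
  have h := iidLaw_inter_dropSeq D.μ n (D.measurableSet_visit_section ξ i n)
    (measurable_pi_apply 0 hV)
  rw [(measurePreserving_eval_infinitePi (fun _ : ℕ => D.μ) 0).measure_preimage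
    hV.nullMeasurableSet] at h
  exact h

lemma prob_goRight (ξ : Ω) (i n : ℕ) :
    D.ν {ω | (ξ, ω) ∈ D.goRight i n} = D.ν {ω | (ξ, ω) ∈ D.visit i n} *
      (D.a (D.S (-(i : ℤ)) ξ) / (D.a (D.S (-(i : ℤ)) ξ) + D.b (D.S (-(i : ℤ)) ξ))) := by
  rw [← D.law]
  exact D.prob_visit_inter_mark ξ i n (measurable_prodMk_left (x := D.S (-(i : ℤ)) ξ)
    D.measurableSet_J)

lemma prob_goLeft (ξ : Ω) (i n : ℕ) :
    D.ν {ω | (ξ, ω) ∈ D.goLeft i n} = D.ν {ω | (ξ, ω) ∈ D.visit i n} *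
      (D.b (D.S (-(i : ℤ)) ξ) / (D.a (D.S (-(i : ℤ)) ξ) + D.b (D.S (-(i : ℤ)) ξ))) := by
  rw [add_comm, ← D.law_compl]
  exact D.prob_visit_inter_mark ξ i n (measurable_prodMk_left (x := D.S (-(i : ℤ)) ξ)
    D.measurableSet_J.compl)

variable {D}

lemma X_succ_of_goRight {i n : ℕ} {p : Ω × (ℕ → U)} (h : p ∈ D.goRight i n) :
    D.X p (n + 1) = -(i : ℤ) + 1 := by
  have h1 : D.X p n = -(i : ℤ) := h.1.2
  rw [D.X_succ_of_mem (by rw [h1]; exact h.2), h1]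

lemma X_succ_of_goLeft {i n : ℕ} {p : Ω × (ℕ → U)} (h : p ∈ D.goLeft i n) :
    D.X p (n + 1) = -(i : ℤ) - 1 := by
  have h1 : D.X p n = -(i : ℤ) := h.1.2
  rw [D.X_succ_of_notMem (by rw [h1]; exact h.2), h1]

lemma alive_succ_iff {n : ℕ} {p : Ω × (ℕ → U)} :
    p ∈ D.alive (n + 1) ↔ p ∈ D.alive n ∧ D.X p (n + 1) ≤ 0 := by
  constructor
  · exact fun h => ⟨fun m hm => h m (by omega), h _ le_rfl⟩
  · rintro ⟨h1, h2⟩ m hm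
    rcases Nat.lt_or_ge n m with h | h
    · rwa [show m = n + 1 by omega]
    · exact h1 m h

lemma goRight_or_goLeft {i n : ℕ} {p : Ω × (ℕ → U)} (h : p ∈ D.visit i n) :
    p ∈ D.goRight i n ∨ p ∈ D.goLeft i n := by
  by_cases hJ : (D.S (-(i : ℤ)) p.1, p.2 n) ∈ D.J
  · exact Or.inl ⟨h, hJ⟩
  · exact Or.inr ⟨h, hJ⟩

variable (D)

/-- Conservation of mass: the only exit from the nonpositive sites is a right step from 0. -/
lemma alive_succ_union (n : ℕ) : D.alive (n + 1) ∪ D.goRight 0 n = D.alive n := by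
  ext p
  constructor
  · rintro (h | h)
    · exact (alive_succ_iff.1 h).1
    · exact h.1.1
  · intro h
    have h0 := h n le_rfl
    rcases h0.lt_or_eq with h1 | h1
    · have := D.X_succ_le p n
      exact Or.inl (alive_succ_iff.2 ⟨h, by omega⟩)
    · rcases goRight_or_goLeft (i := 0) (n := n) (p := p) ⟨h, by simpa using h1⟩ with h2 | h2
      · exact Or.inr h2
      · have := X_succ_of_goLeft h2
        exact Or.inl (alive_succ_iff.2 ⟨h, by push_cast at this; omega⟩)

lemma disjoint_alive_goRight (n : ℕ) : Disjoint (D.alive (n + 1)) (D.goRight 0 n) := by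
  rw [Set.disjoint_left]
  intro p h1 h2
  have h3 := X_succ_of_goRight h2
  have h4 := h1 (n + 1) le_rfl
  push_cast at h3
  omega

/-- Conservation of mass across one edge: the region left of `-i` is entered only from `-i` and left
only from `-(i + 1)`. -/
lemma below_succ_union (i n : ℕ) :
    D.below i (n + 1) ∪ D.goRight (i + 1) n = D.below i n ∪ D.goLeft i n := by
  ext p
  constructor
  · rintro (h | h)
    · have ha := alive_succ_iff.1 h.1
      have hx : D.X p (n + 1) < -(i : ℤ) := h.2
      have hs := D.le_X_succ p n
      rcases lt_or_ge (D.X p n) (-(i : ℤ)) with hlt | hge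
      · exact Or.inl ⟨ha.1, hlt⟩
      · have he : D.X p n = -(i : ℤ) := by omega
        rcases goRight_or_goLeft (i := i) (n := n) (p := p) ⟨ha.1, he⟩ with h2 | h2
        · have := X_succ_of_goRight h2
          omega
        · exact Or.inr h2
    · refine Or.inl ⟨h.1.1, ?_⟩
      have : D.X p n = -((i + 1 : ℕ) : ℤ) := h.1.2
      show D.X p n < -(i : ℤ)
      push_cast at this
      omega
  · rintro (h | h)
    · have hx : D.X p n < -(i : ℤ) := h.2
      have hs := D.X_succ_le p n
      rcases lt_or_ge (D.X p n) (-(i : ℤ) - 1) with hlt | hge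
      · refine Or.inl ⟨alive_succ_iff.2 ⟨h.1, by omega⟩, ?_⟩
        show D.X p (n + 1) < -(i : ℤ)
        omega
      · have he : D.X p n = -((i + 1 : ℕ) : ℤ) := by push_cast; omega
        rcases goRight_or_goLeft (i := i + 1) (n := n) (p := p) ⟨h.1, he⟩ with h2 | h2
        · exact Or.inr h2
        · have := X_succ_of_goLeft h2
          push_cast at this
          refine Or.inl ⟨alive_succ_iff.2 ⟨h.1, by omega⟩, ?_⟩
          show D.X p (n + 1) < -(i : ℤ)
          omega
    · have := X_succ_of_goLeft h
      refine Or.inl ⟨alive_succ_iff.2 ⟨h.1.1, by omega⟩, ?_⟩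
      show D.X p (n + 1) < -(i : ℤ)
      omega

lemma disjoint_below_goRight (i n : ℕ) : Disjoint (D.below i (n + 1)) (D.goRight (i + 1) n) := by
  rw [Set.disjoint_left]
  intro p h1 h2
  have h3 := X_succ_of_goRight h2
  have h4 : D.X p (n + 1) < -(i : ℤ) := h1.2
  push_cast at h3
  omega

lemma disjoint_below_goLeft (i n : ℕ) : Disjoint (D.below i n) (D.goLeft i n) := by
  rw [Set.disjoint_left]
  intro p h1 h2
  have h3 : D.X p n = -(i : ℤ) := h2.1.2
  have h4 : D.X p n < -(i : ℤ) := h1.2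
  omega

lemma measure_section_union (ξ : Ω) {A B : Set (Ω × (ℕ → U))} (hd : Disjoint A B)
    (hB : MeasurableSet B) :
    D.ν {ω | (ξ, ω) ∈ A ∪ B} = D.ν {ω | (ξ, ω) ∈ A} + D.ν {ω | (ξ, ω) ∈ B} :=
  measure_union (Set.disjoint_left.2 fun _ h1 h2 => Set.disjoint_left.1 hd h1 h2)
    (measurable_section hB ξ)

lemma prob_alive_add_sum (ξ : Ω) (M : ℕ) :
    D.ν {ω | (ξ, ω) ∈ D.alive M} + ∑ n ∈ Finset.range M, D.ν {ω | (ξ, ω) ∈ D.goRight 0 n} = 1 := by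
  induction M with
  | zero =>
    have : {ω | (ξ, ω) ∈ D.alive 0} = Set.univ :=
      Set.eq_univ_of_forall fun ω m hm => by simp [Nat.le_zero.1 hm]
    simp [this]
  | succ M ih =>
    rw [← ih, ← D.alive_succ_union M, D.measure_section_union ξ (D.disjoint_alive_goRight M)
      (D.measurableSet_goRight 0 M), Finset.sum_range_succ]
    ring

lemma prob_below_add_sum (ξ : Ω) (i M : ℕ) :
    D.ν {ω | (ξ, ω) ∈ D.below i M} +
        ∑ n ∈ Finset.range M, D.ν {ω | (ξ, ω) ∈ D.goRight (i + 1) n}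
      = ∑ n ∈ Finset.range M, D.ν {ω | (ξ, ω) ∈ D.goLeft i n} := by
  induction M with
  | zero =>
    have : {ω | (ξ, ω) ∈ D.below i 0} = ∅ := by
      refine Set.eq_empty_of_forall_notMem fun ω hω => ?_
      have h : D.X (ξ, ω) 0 < -(i : ℤ) := hω.2
      rw [X_zero] at h
      omega
    simp [this]
  | succ M ih =>
    have h := congrArg (fun T => D.ν {ω | (ξ, ω) ∈ T}) (D.below_succ_union i M)
    rw [D.measure_section_union ξ (D.disjoint_below_goRight i M) (D.measurableSet_goRight _ M),
      D.measure_section_union ξ (D.disjoint_below_goLeft i M) (D.measurableSet_goLeft _ M)] at h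
    rw [Finset.sum_range_succ, Finset.sum_range_succ, ← ih]
    calc _ = (D.ν {ω | (ξ, ω) ∈ D.below i (M + 1)} + D.ν {ω | (ξ, ω) ∈ D.goRight (i + 1) M})
          + ∑ n ∈ Finset.range M, D.ν {ω | (ξ, ω) ∈ D.goRight (i + 1) n} := by ring
      _ = _ := by rw [h]; ring

lemma tendsto_prob_alive {ξ : Ω} (h : ∀ᵐ ω ∂D.ν, (ξ, ω) ∈ D.hit 1) :
    Tendsto (fun M => D.ν {ω | (ξ, ω) ∈ D.alive M}) atTop (𝓝 0) := by
  have h1 : D.ν (⋂ M, {ω | (ξ, ω) ∈ D.alive M}) = 0 := by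
    rw [measure_eq_zero_iff_ae_notMem]
    filter_upwards [h] with ω ⟨n, hn⟩ hω
    have := Set.mem_iInter.1 hω n n le_rfl
    push_cast at hn
    omega
  rw [← h1]
  refine tendsto_measure_iInter_atTop
    (fun M => (measurable_section (D.measurableSet_alive M) ξ).nullMeasurableSet)
    (fun m n hmn ω hω k hk => hω k (hk.trans hmn)) ⟨0, measure_ne_top _ _⟩

/-- The expected number of visits to `-i` before the walk becomes positive. -/
noncomputable def green (ξ : Ω) (i : ℕ) : ℝ≥0∞ := ∑' n, D.ν {ω | (ξ, ω) ∈ D.visit i n}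

/-- The expected time spent at `-i` before the walk becomes positive. -/
noncomputable def timeAt (ξ : Ω) (i : ℕ) : ℝ≥0∞ :=
  D.green ξ i / (D.a (D.S (-(i : ℤ)) ξ) + D.b (D.S (-(i : ℤ)) ξ))

lemma tsum_prob_goRight (ξ : Ω) (i : ℕ) :
    ∑' n, D.ν {ω | (ξ, ω) ∈ D.goRight i n} = D.timeAt ξ i * D.a (D.S (-(i : ℤ)) ξ) := by
  simp_rw [prob_goRight, timeAt, green]
  rw [ENNReal.tsum_mul_right, div_eq_mul_inv, div_eq_mul_inv]
  ring

lemma tsum_prob_goLeft (ξ : Ω) (i : ℕ) :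
    ∑' n, D.ν {ω | (ξ, ω) ∈ D.goLeft i n} = D.timeAt ξ i * D.b (D.S (-(i : ℤ)) ξ) := by
  simp_rw [prob_goLeft, timeAt, green]
  rw [ENNReal.tsum_mul_right, div_eq_mul_inv, div_eq_mul_inv]
  ring

/-- The left side is the expected number of right steps from 0 before becoming positive, and at most
one such step can occur. -/
lemma timeAt_zero_mul_le (ξ : Ω) : D.timeAt ξ 0 * D.a (D.S (-((0 : ℕ) : ℤ)) ξ) ≤ 1 := by
  rw [← tsum_prob_goRight, ENNReal.tsum_eq_iSup_nat]
  refine iSup_le fun M => ?_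
  rw [← D.prob_alive_add_sum ξ M]
  exact le_add_self

/-- Started on the right of the edge, the walk cannot cross it more often to the right than to the
left. -/
lemma timeAt_succ_mul_le (ξ : Ω) (i : ℕ) :
    D.timeAt ξ (i + 1) * D.a (D.S (-((i + 1 : ℕ) : ℤ)) ξ)
      ≤ D.timeAt ξ i * D.b (D.S (-(i : ℤ)) ξ) := by
  rw [← tsum_prob_goRight, ← tsum_prob_goLeft, ENNReal.tsum_eq_iSup_nat,
    ENNReal.tsum_eq_iSup_nat]
  refine iSup_mono fun M => ?_
  rw [← D.prob_below_add_sum ξ i M]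
  exact le_add_self

lemma timeAt_zero_mul_eq {ξ : Ω} (h : ∀ᵐ ω ∂D.ν, (ξ, ω) ∈ D.hit 1) :
    D.timeAt ξ 0 * D.a (D.S (-((0 : ℕ) : ℤ)) ξ) = 1 := by
  rw [← tsum_prob_goRight]
  have h1 := (D.tendsto_prob_alive h).add
    (ENNReal.tendsto_nat_tsum fun n => D.ν {ω | (ξ, ω) ∈ D.goRight 0 n})
  simp_rw [prob_alive_add_sum, zero_add] at h1
  exact tendsto_nhds_unique h1 tendsto_const_nhds

/-- The defect in the flow balance is the mass still left of the edge, which vanishes in the limit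
when level 1 is certain to be reached. -/
lemma timeAt_succ_mul_eq {ξ : Ω} (h : ∀ᵐ ω ∂D.ν, (ξ, ω) ∈ D.hit 1) (i : ℕ) :
    D.timeAt ξ (i + 1) * D.a (D.S (-((i + 1 : ℕ) : ℤ)) ξ)
      = D.timeAt ξ i * D.b (D.S (-(i : ℤ)) ξ) := by
  rw [← tsum_prob_goRight, ← tsum_prob_goLeft]
  have h0 : Tendsto (fun M => D.ν {ω | (ξ, ω) ∈ D.below i M}) atTop (𝓝 0) :=
    tendsto_of_tendsto_of_tendsto_of_le_of_le tendsto_const_nhds (D.tendsto_prob_alive h)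
      (fun M => zero_le) fun M => measure_mono fun ω hω => hω.1
  have h1 := h0.add
    (ENNReal.tendsto_nat_tsum fun n => D.ν {ω | (ξ, ω) ∈ D.goRight (i + 1) n})
  simp_rw [prob_below_add_sum, zero_add] at h1
  exact tendsto_nhds_unique h1 (ENNReal.tendsto_nat_tsum _)

/-- The `i`-th term of the series `Ŝ`. -/
noncomputable def sTerm (ξ : Ω) (i : ℕ) : ℝ≥0∞ :=
  (D.a (D.S (-(i : ℤ)) ξ) : ℝ≥0∞)⁻¹ * ∏ j ∈ Finset.range i,
    ((D.b (D.S (-(j : ℤ)) ξ) : ℝ≥0∞) / D.a (D.S (-(j : ℤ)) ξ))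

/-- The series `Ŝ`. -/
noncomputable def sSeries (ξ : Ω) : ℝ≥0∞ := ∑' i, D.sTerm ξ i

lemma measurable_sSeries : Measurable D.sSeries := by
  refine Measurable.tsum fun i => ?_
  have ha : ∀ j : ℕ, Measurable fun ξ => (D.a (D.S (-(j : ℤ)) ξ) : ℝ≥0∞) := fun j =>
    (D.measurable_a.comp (D.measurable_S _)).coe_nnreal_ennreal
  have hb : ∀ j : ℕ, Measurable fun ξ => (D.b (D.S (-(j : ℤ)) ξ) : ℝ≥0∞) := fun j =>
    (D.measurable_b.comp (D.measurable_S _)).coe_nnreal_ennreal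
  exact (ha i).inv.mul (Finset.measurable_prod _ fun j _ => (hb j).div (ha j))

lemma le_sTerm_iff (ξ : Ω) (i : ℕ) (t : ℝ≥0∞) :
    t ≤ D.sTerm ξ i ↔ t * D.a (D.S (-(i : ℤ)) ξ) ≤ ∏ j ∈ Finset.range i,
      ((D.b (D.S (-(j : ℤ)) ξ) : ℝ≥0∞) / D.a (D.S (-(j : ℤ)) ξ)) := by
  rw [sTerm, mul_comm _ (∏ j ∈ _, _), ← div_eq_mul_inv]
  exact ENNReal.le_div_iff_mul_le (Or.inl (by simpa using (D.a_pos _).ne')) (Or.inl (by simp))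

lemma timeAt_mul_le (ξ : Ω) (i : ℕ) :
    D.timeAt ξ i * D.a (D.S (-(i : ℤ)) ξ) ≤ ∏ j ∈ Finset.range i,
      ((D.b (D.S (-(j : ℤ)) ξ) : ℝ≥0∞) / D.a (D.S (-(j : ℤ)) ξ)) := by
  induction i with
  | zero => simpa using D.timeAt_zero_mul_le ξ
  | succ i ih =>
    refine (D.timeAt_succ_mul_le ξ i).trans ?_
    rw [Finset.prod_range_succ, mul_div_assoc']
    rw [ENNReal.le_div_iff_mul_le (Or.inl (by simpa using (D.a_pos _).ne')) (Or.inl (by simp)),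
      mul_right_comm]
    gcongr

lemma timeAt_le (ξ : Ω) (i : ℕ) : D.timeAt ξ i ≤ D.sTerm ξ i :=
  (D.le_sTerm_iff ξ i _).2 (D.timeAt_mul_le ξ i)

lemma timeAt_eq {ξ : Ω} (h : ∀ᵐ ω ∂D.ν, (ξ, ω) ∈ D.hit 1) (i : ℕ) :
    D.timeAt ξ i = D.sTerm ξ i := by
  have ha : ∀ i : ℕ, (D.a (D.S (-(i : ℤ)) ξ) : ℝ≥0∞) ≠ 0 := fun i => by
    simpa using (D.a_pos _).ne'
  have key : D.timeAt ξ i * D.a (D.S (-(i : ℤ)) ξ) = ∏ j ∈ Finset.range i,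
      ((D.b (D.S (-(j : ℤ)) ξ) : ℝ≥0∞) / D.a (D.S (-(j : ℤ)) ξ)) := by
    induction i with
    | zero => simpa using D.timeAt_zero_mul_eq h
    | succ i ih =>
      rw [D.timeAt_succ_mul_eq h i, Finset.prod_range_succ, ← ih, mul_assoc,
        ENNReal.mul_div_cancel (ha i) (by simp)]
  rw [sTerm, ← key, mul_comm (D.timeAt ξ i), ← mul_assoc, ENNReal.inv_mul_cancel (ha i) (by simp),
    one_mul]

lemma sTerm_ne_top (ξ : Ω) (i : ℕ) : D.sTerm ξ i ≠ ∞ := by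
  have ha : ∀ i : ℕ, (D.a (D.S (-(i : ℤ)) ξ) : ℝ≥0∞) ≠ 0 := fun i => by
    simpa using (D.a_pos _).ne'
  refine ENNReal.mul_ne_top (ENNReal.inv_ne_top.2 (ha i)) (ENNReal.prod_ne_top fun j _ => ?_)
  exact (ENNReal.div_lt_top (by simp) (ha j)).ne

lemma sum_rates_ne_top (ξ : Ω) : (D.a ξ + D.b ξ : ℝ≥0∞) ≠ ∞ := by simp

lemma green_ne_top (ξ : Ω) (i : ℕ) : D.green ξ i ≠ ∞ := by
  intro h
  have h1 := D.timeAt_le ξ i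
  rw [timeAt, h, ENNReal.top_div_of_ne_top (D.sum_rates_ne_top _)] at h1
  exact D.sTerm_ne_top ξ i (top_le_iff.1 h1)

/-- The total time spent before the walk becomes positive. -/
noncomputable def total (p : Ω × (ℕ → U)) : ℝ≥0∞ :=
  ∑' n, (D.alive n).indicator (fun p => (D.hold (D.after n p) : ℝ≥0∞)) p

lemma measurable_total : Measurable D.total :=
  Measurable.tsum fun n => ((D.measurable_hold.comp (D.measurable_after n)).coe_nnreal_ennreal
    ).indicator (D.measurableSet_alive n)

lemma indicator_alive_eq (n : ℕ) (p : Ω × (ℕ → U)) :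
    (D.alive n).indicator (fun p => (D.hold (D.after n p) : ℝ≥0∞)) p
      = ∑' i : ℕ, (D.visit i n).indicator (fun _ => (1 : ℝ≥0∞)) p * (D.W (p.2 n) /
        (D.a (D.S (-(i : ℤ)) p.1) + D.b (D.S (-(i : ℤ)) p.1))) := by
  by_cases h : p ∈ D.alive n
  · obtain ⟨i, hi⟩ : ∃ i : ℕ, D.X p n = -(i : ℤ) :=
      ⟨(D.X p n).natAbs, by have := h n le_rfl; omega⟩
    rw [tsum_eq_single i]
    · rw [Set.indicator_of_mem h, Set.indicator_of_mem (show p ∈ D.visit i n from ⟨h, hi⟩), one_mul]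
      rw [hold, ENNReal.coe_div (add_pos (D.a_pos _) (D.b_pos _)).ne', ENNReal.coe_add]
      simp only [after, hi, dropSeq_apply, add_zero]
    · intro j hj
      rw [Set.indicator_of_notMem, zero_mul]
      rintro ⟨_, h2⟩
      have h2' : D.X p n = -(j : ℤ) := h2
      omega
  · rw [Set.indicator_of_notMem h, ENNReal.tsum_eq_zero.2]
    intro i
    rw [Set.indicator_of_notMem (fun h' => h h'.1), zero_mul]

/-- The clock at step n has mean 1 and is independent of the path up to n, so each visit costs on
average the inverse of the total rate at its site. -/
lemma lintegral_total (ξ : Ω) : ∫⁻ ω, D.total (ξ, ω) ∂D.ν = ∑' i, D.timeAt ξ i := by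
  have := D.nonempty_marks
  simp_rw [total, indicator_alive_eq]
  have hm : ∀ n i : ℕ, Measurable fun ω : ℕ → U =>
      (D.visit i n).indicator (fun _ => (1 : ℝ≥0∞)) (ξ, ω) * (D.W (ω n) /
        (D.a (D.S (-(i : ℤ)) ξ) + D.b (D.S (-(i : ℤ)) ξ))) := fun n i => by
    refine Measurable.mul ?_ ?_
    · exact (measurable_const.indicator (D.measurableSet_visit i n)).comp measurable_prodMk_left
    · exact ((D.measurable_W.comp (measurable_pi_apply n)).coe_nnreal_ennreal).div_const _
  have hterm : ∀ n i : ℕ, ∫⁻ ω, (D.visit i n).indicator (fun _ => (1 : ℝ≥0∞)) (ξ, ω) * (D.W (ω n) /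
        (D.a (D.S (-(i : ℤ)) ξ) + D.b (D.S (-(i : ℤ)) ξ))) ∂D.ν
      = D.ν {ω | (ξ, ω) ∈ D.visit i n} / (D.a (D.S (-(i : ℤ)) ξ) + D.b (D.S (-(i : ℤ)) ξ)) := by
    intro n i
    have h := lintegral_indicator_mul_coord D.μ n (D.measurableSet_visit_section ξ i n)
      (g := fun u => (D.W u : ℝ≥0∞) / (D.a (D.S (-(i : ℤ)) ξ) + D.b (D.S (-(i : ℤ)) ξ)))
      (D.measurable_W.coe_nnreal_ennreal.div_const _)
    have hW : ∫⁻ u, (D.W u : ℝ≥0∞) / (D.a (D.S (-(i : ℤ)) ξ) + D.b (D.S (-(i : ℤ)) ξ)) ∂D.μ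
        = 1 / (D.a (D.S (-(i : ℤ)) ξ) + D.b (D.S (-(i : ℤ)) ξ)) := by
      simp_rw [div_eq_mul_inv]
      rw [lintegral_mul_const _ D.measurable_W.coe_nnreal_ennreal, D.lintegral_W]
    rw [hW, mul_one_div] at h
    exact h
  rw [lintegral_tsum fun n => (Measurable.tsum (hm n)).aemeasurable]
  simp_rw [lintegral_tsum fun i => (hm _ i).aemeasurable, hterm]
  rw [ENNReal.tsum_comm]
  simp_rw [div_eq_mul_inv, ENNReal.tsum_mul_right, timeAt, green, div_eq_mul_inv]

lemma lintegral_total_le (ξ : Ω) : ∫⁻ ω, D.total (ξ, ω) ∂D.ν ≤ D.sSeries ξ := by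
  rw [lintegral_total]
  exact ENNReal.tsum_le_tsum (D.timeAt_le ξ)

lemma lintegral_total_eq {ξ : Ω} (h : ∀ᵐ ω ∂D.ν, (ξ, ω) ∈ D.hit 1) :
    ∫⁻ ω, D.total (ξ, ω) ∂D.ν = D.sSeries ξ := by
  rw [lintegral_total]
  exact tsum_congr (D.timeAt_eq h)

lemma clk_N_one_eq_total {p : Ω × (ℕ → U)} (h : p ∈ D.hit 1) :
    (D.clk p (D.N 1 p) : ℝ≥0∞) = D.total p := by
  have h1 := first_N h
  have hal : ∀ n, p ∈ D.alive n ↔ n < D.N 1 p := fun n => by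
    constructor
    · intro hn
      by_contra hc
      have h2 := hn _ (not_lt.1 hc)
      have h3 := h1.1
      push_cast at h3
      omega
    · intro hn m hm
      have h2 := h1.2 m (by omega)
      push_cast at h2
      omega
  rw [total, tsum_eq_sum (s := Finset.range (D.N 1 p)), clk, ENNReal.ofNNReal_finsetSum]
  · refine Finset.sum_congr rfl fun n hn => ?_
    rw [Set.indicator_of_mem ((hal n).2 (Finset.mem_range.1 hn))]
  · intro n hn
    rw [Set.indicator_of_notMem]
    rw [hal]
    simpa using hn

lemma clk_le_total {p : Ω × (ℕ → U)} (h : p ∉ D.hit 1) (n : ℕ) :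
    (D.clk p n : ℝ≥0∞) ≤ D.total p := by
  rw [total, clk, ENNReal.ofNNReal_finsetSum]
  refine le_trans (Finset.sum_le_sum fun k _ => ?_) (ENNReal.sum_le_tsum (Finset.range n))
  rw [Set.indicator_of_mem]
  intro m hm
  by_contra hc
  exact h ⟨m, by push_cast; omega⟩

/-- A walk that never becomes positive is unbounded below. -/
lemma ae_hit_one_or_mirror_unb (ξ : Ω) :
    ∀ᵐ ω ∂D.ν, (ξ, ω) ∈ D.hit 1 ∨ (ξ, ω) ∈ D.mirror.unb := by
  -- Borel–Cantelli: each site is visited only finitely often before level 1, so a walk that stays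
  -- nonpositive leaves every finite interval.
  have h : ∀ i, ∀ᵐ ω ∂D.ν, ∀ᶠ n in atTop, ω ∉ {ω | (ξ, ω) ∈ D.visit i n} := fun i =>
    ae_eventually_notMem (D.green_ne_top ξ i)
  filter_upwards [ae_all_iff.2 h] with ω hω
  by_cases hh : (ξ, ω) ∈ D.hit 1
  · exact Or.inl hh
  right
  intro k
  have hal : ∀ n, (ξ, ω) ∈ D.alive n := fun n m _ => by
    by_contra hc
    exact hh ⟨m, by push_cast; omega⟩
  have hev : ∀ᶠ n in atTop, ∀ i ∈ Finset.range k, (ξ, ω) ∉ D.visit i n :=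
    (Finset.range k).eventually_all.2 fun i _ => hω i
  obtain ⟨n, hn⟩ := hev.exists
  refine ⟨n, ?_⟩
  rw [mirror_X]
  by_contra hc
  have hle := hal n n le_rfl
  exact hn (D.X (ξ, ω) n).natAbs (Finset.mem_range.2 (by omega)) ⟨hal n, by
    show D.X (ξ, ω) n = _
    omega⟩

/-- If the walk is almost surely bounded below, then it must become positive from almost every
environment, and hence climbs forever. -/
lemma unb_ae_or_mirror_unb_ae :
    (∀ᵐ p ∂D.Q, p ∈ D.unb) ∨ ∀ᵐ p ∂D.Q, p ∈ D.mirror.unb := by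
  rcases D.mirror.unb_ae_or_bounded_ae with h | h
  · exact Or.inr h
  left
  refine D.unb_ae_of_hit_one ?_
  have h' := (D.ae_Q_iff D.mirror.measurableSet_unb.compl).1 h
  filter_upwards [h'] with ξ hξ
  refine (mem_ae_iff_prob_eq_one (measurable_section (D.measurableSet_hit 1) ξ)).1 ?_
  filter_upwards [hξ, D.ae_hit_one_or_mirror_unb ξ] with ω h1 h2
  exact h2.resolve_right h1

end WalkSystem

/-! ### Growth of the hitting times, absence of explosion, and bounds on the speed. -/

/-- The witness is the last good index `j < k`: all good indices lie in `{0, …, j}`. -/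
lemma exists_lt_sum_indicator_le {good : ℕ → ℝ} (h01 : ∀ j, good j = 0 ∨ good j = 1) (k : ℕ)
    (hpos : 0 < ∑ j ∈ Finset.range k, good j) :
    ∃ j < k, good j = 1 ∧ ∑ j ∈ Finset.range k, good j ≤ j + 1 := by
  have hle : ∀ k : ℕ, ∑ j ∈ Finset.range k, good j ≤ k := fun k => by
    have : ∑ j ∈ Finset.range k, good j ≤ ∑ j ∈ Finset.range k, (1 : ℝ) :=
      Finset.sum_le_sum fun j _ => by rcases h01 j with h | h <;> rw [h]; exact zero_le_one
    simpa using this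
  induction k with
  | zero => simp at hpos
  | succ k ih =>
    rcases h01 k with h | h
    · rw [Finset.sum_range_succ, h, add_zero] at hpos ⊢
      obtain ⟨j, hj, h1, h2⟩ := ih hpos
      exact ⟨j, by omega, h1, h2⟩
    · exact ⟨k, by omega, h, by simpa using hle (k + 1)⟩

namespace WalkSystem

variable {Ω U : Type*} [MeasurableSpace Ω] [MeasurableSpace U] (D : WalkSystem Ω U)

lemma neg_le_X (p : Ω × (ℕ → U)) (n : ℕ) : -(n : ℤ) ≤ D.X p n := by
  have := D.mirror.X_le p n
  rw [mirror_X] at this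
  omega

/-- The expectation of `Ŝ`. -/
noncomputable def meanS : ℝ≥0∞ := ∫⁻ ξ, D.sSeries ξ ∂D.P

lemma sSeries_pos (ξ : Ω) : 0 < D.sSeries ξ := by
  refine lt_of_lt_of_le ?_ (ENNReal.le_tsum 0)
  rw [sTerm, Finset.prod_range_zero, mul_one]
  exact ENNReal.inv_pos.2 ENNReal.coe_ne_top

lemma meanS_pos : 0 < D.meanS := by
  rw [meanS, lintegral_pos_iff_support D.measurable_sSeries]
  have : Function.support D.sSeries = Set.univ :=
    Set.eq_univ_of_forall fun ξ => (D.sSeries_pos ξ).ne'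
  rw [this, measure_univ]
  exact one_pos

lemma lintegral_total_Q_le : ∫⁻ p, D.total p ∂D.Q ≤ D.meanS := by
  rw [lintegral_prod _ D.measurable_total.aemeasurable]
  exact lintegral_mono D.lintegral_total_le

/-- The time at which the walk first reaches level `1`. -/
noncomputable def τ (p : Ω × (ℕ → U)) : ℝ≥0 := D.clk p (D.N 1 p)

lemma measurable_τ : Measurable D.τ := by
  have h : Measurable fun q : ℕ × (Ω × (ℕ → U)) => D.clk q.2 q.1 :=
    measurable_from_prod_countable_right D.measurable_clk
  have h1 := h.comp ((D.measurable_N 1).prodMk measurable_id)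
  exact h1

variable {D}

lemma lintegral_τ (h : ∀ᵐ p ∂D.Q, p ∈ D.unb) : ∫⁻ p, D.τ p ∂D.Q = D.meanS := by
  have h1 : ∫⁻ p, D.τ p ∂D.Q = ∫⁻ p, D.total p ∂D.Q := by
    refine lintegral_congr_ae ?_
    filter_upwards [h] with p hp using D.clk_N_one_eq_total (hp 1)
  rw [h1, lintegral_prod _ D.measurable_total.aemeasurable, meanS]
  refine lintegral_congr_ae ?_
  filter_upwards [ae_hit_of_unb h 1] with ξ hξ using D.lintegral_total_eq hξ

lemma birkhoffSum_τ {p : Ω × (ℕ → U)} (h : p ∈ D.unb) (k : ℕ) :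
    birkhoffSum (D.Φ 1) (fun p => (D.τ p : ℝ)) k p = D.clk p (D.N k p) := by
  induction k with
  | zero => simp [N_zero, clk_zero]
  | succ k ih =>
    rw [birkhoffSum_succ, ih, iterate_Φ h, N_add (h _), clk_add]
    push_cast
    rfl

/-- Truncating `τ` at a large `K` makes it integrable with mean still above `c`, so an infinite mean
is allowed. -/
lemma ae_eventually_le_clk_N (h : ∀ᵐ p ∂D.Q, p ∈ D.unb) {c : ℝ} (hc0 : 0 ≤ c)
    (hc : ENNReal.ofReal c < D.meanS) :
    ∀ᵐ p ∂D.Q, ∀ᶠ k : ℕ in atTop, c * k ≤ D.clk p (D.N k p) := by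
  have hsup : ⨆ K : ℕ, ∫⁻ p, ((min (D.τ p) K : ℝ≥0) : ℝ≥0∞) ∂D.Q = D.meanS := by
    rw [← lintegral_τ h, ← lintegral_iSup]
    · refine lintegral_congr fun p => le_antisymm (iSup_le fun K => ?_) ?_
      · exact_mod_cast min_le_left _ _
      · obtain ⟨K, hK⟩ := exists_nat_ge (D.τ p)
        refine le_iSup_of_le K ?_
        rw [min_eq_left hK]
    · exact fun K => (D.measurable_τ.min measurable_const).coe_nnreal_ennreal
    · intro K L hKL p
      have : ((K : ℝ≥0)) ≤ L := by exact_mod_cast hKL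
      exact ENNReal.coe_le_coe.2 (min_le_min le_rfl this)
  obtain ⟨K, hK⟩ := lt_iSup_iff.1 (hc.trans_eq hsup.symm)
  have hgm : Measurable fun p => ((min (D.τ p) K : ℝ≥0) : ℝ) :=
    (D.measurable_τ.min measurable_const).coe_nnreal_real
  have hg : Integrable (fun p => ((min (D.τ p) K : ℝ≥0) : ℝ)) D.Q := by
    refine Integrable.of_bound hgm.aestronglyMeasurable (K : ℝ) (ae_of_all _ fun p => ?_)
    rw [Real.norm_of_nonneg (NNReal.coe_nonneg _)]
    exact_mod_cast min_le_right _ _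
  have hint : c < ∫ p, ((min (D.τ p) K : ℝ≥0) : ℝ) ∂D.Q := by
    rw [integral_eq_lintegral_of_nonneg_ae (ae_of_all _ fun p => NNReal.coe_nonneg _)
      hgm.aestronglyMeasurable]
    simp_rw [ENNReal.ofReal_coe_nnreal]
    refine (ENNReal.ofReal_lt_iff_lt_toReal hc0 ?_).1 hK
    refine ((lintegral_mono (g := fun _ => (K : ℝ≥0∞)) fun p => ?_).trans_lt ?_).ne
    · exact ENNReal.coe_le_coe.2 (min_le_right _ _)
    · simp
  filter_upwards [h, ae_eventually_le_birkhoffSum (ergodic_Φ h) hgm hg hint] with p hp hev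
  filter_upwards [hev] with k hk
  rw [← birkhoffSum_τ hp k]
  refine hk.trans (Finset.sum_le_sum fun j _ => ?_)
  exact_mod_cast min_le_left _ _

lemma ae_eventually_clk_N_le (h : ∀ᵐ p ∂D.Q, p ∈ D.unb) (hS : D.meanS ≠ ∞) {c : ℝ}
    (hc : D.meanS.toReal < c) :
    ∀ᵐ p ∂D.Q, ∀ᶠ k : ℕ in atTop, D.clk p (D.N k p) ≤ c * k := by
  have hgm : Measurable fun p => (D.τ p : ℝ) := D.measurable_τ.coe_nnreal_real
  have hL : ∫⁻ p, ENNReal.ofReal (D.τ p : ℝ) ∂D.Q = D.meanS := by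
    simp_rw [ENNReal.ofReal_coe_nnreal]
    exact lintegral_τ h
  have hg : Integrable (fun p => (D.τ p : ℝ)) D.Q := by
    refine ⟨hgm.aestronglyMeasurable, ?_⟩
    rw [hasFiniteIntegral_iff_ofReal (ae_of_all _ fun p => NNReal.coe_nonneg _), hL]
    exact hS.lt_top
  have hint : ∫ p, (D.τ p : ℝ) ∂D.Q < c := by
    rw [integral_eq_lintegral_of_nonneg_ae (ae_of_all _ fun p => NNReal.coe_nonneg _)
      hgm.aestronglyMeasurable, hL]
    exact hc
  filter_upwards [h, ae_eventually_birkhoffSum_le (ergodic_Φ h) hgm hg hint] with p hp hev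
  filter_upwards [hev] with k hk
  rwa [← birkhoffSum_τ hp k]

/-- Since `meanS` is positive, the hitting times of the levels grow at least linearly. -/
lemma tendsto_clk_of_unb (h : ∀ᵐ p ∂D.Q, p ∈ D.unb) :
    ∀ᵐ p ∂D.Q, Tendsto (fun n => (D.clk p n : ℝ)) atTop atTop := by
  obtain ⟨d, hd0, hd⟩ := exists_between D.meanS_pos
  have hdT : d ≠ ∞ := ne_top_of_lt hd
  filter_upwards [ae_eventually_le_clk_N h (c := d.toReal) ENNReal.toReal_nonneg
    (by rwa [ENNReal.ofReal_toReal hdT])] with p hp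
  refine tendsto_atTop_atTop_of_monotone
    (fun m n hmn => NNReal.coe_le_coe.2 (D.clk_mono p hmn)) fun b => ?_
  have ht : Tendsto (fun k : ℕ => d.toReal * (k : ℝ)) atTop atTop :=
    tendsto_natCast_atTop_atTop.const_mul_atTop (ENNReal.toReal_pos hd0.ne' hdT)
  obtain ⟨k, h1, h2⟩ := (hp.and (ht.eventually_ge_atTop b)).exists
  exact ⟨_, h2.trans h1⟩

variable (D)

/-- The walk does not explode. -/
theorem ae_tendsto_clk : ∀ᵐ p ∂D.Q, Tendsto (fun n => (D.clk p n : ℝ)) atTop atTop := by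
  rcases D.unb_ae_or_mirror_unb_ae with h | h
  · exact tendsto_clk_of_unb h
  · have := tendsto_clk_of_unb (D := D.mirror) h
    simp_rw [mirror_clk] at this
    exact this

/-- On paths that never reach level 1, all jump times are bounded by `total`, which is almost surely
finite; this contradicts non-explosion. -/
lemma unb_ae_of_meanS_ne_top (hS : D.meanS ≠ ∞) : ∀ᵐ p ∂D.Q, p ∈ D.unb := by
  have h1 : ∀ᵐ p ∂D.Q, D.total p < ∞ :=
    ae_lt_top D.measurable_total (D.lintegral_total_Q_le.trans_lt hS.lt_top).ne
  have h2 : ∀ᵐ p ∂D.Q, p ∈ D.hit 1 := by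
    filter_upwards [h1, D.ae_tendsto_clk] with p hp ht
    by_contra hc
    obtain ⟨n, hn⟩ := (ht.eventually_gt_atTop (D.total p).toReal).exists
    have h3 := ENNReal.toReal_mono hp.ne (D.clk_le_total hc n)
    rw [ENNReal.coe_toReal] at h3
    exact absurd h3 (not_le.2 hn)
  refine D.unb_ae_of_hit_one ?_
  filter_upwards [(D.ae_Q_iff (D.measurableSet_hit 1)).1 h2] with ξ hξ
  exact (mem_ae_iff_prob_eq_one (measurable_section (D.measurableSet_hit 1) ξ)).1 hξ

variable {D}

lemma N_mono {p : Ω × (ℕ → U)} (h : p ∈ D.unb) : Monotone fun k => D.N k p := fun k l hkl => by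
  obtain ⟨m, rfl⟩ := Nat.exists_eq_add_of_le hkl
  show D.N k p ≤ D.N (k + m) p
  rw [N_add (h _)]
  exact Nat.le_add_right _ _

lemma exists_level {p : Ω × (ℕ → U)} (h : p ∈ D.unb) {i₀ n : ℕ} (hn : D.N i₀ p ≤ n) :
    ∃ i, i₀ ≤ i ∧ D.N i p ≤ n ∧ n < D.N (i + 1) p := by
  classical
  have h0 : i₀ ≤ n := (le_N (h i₀)).trans hn
  refine ⟨Nat.findGreatest (fun i => D.N i p ≤ n) n, Nat.le_findGreatest h0 hn,
    Nat.findGreatest_spec (P := fun i => D.N i p ≤ n) h0 hn, ?_⟩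
  by_contra hc
  have h1 := not_lt.1 hc
  have h2 := (le_N (h _)).trans h1
  exact Nat.findGreatest_is_greatest (P := fun i => D.N i p ≤ n) (Nat.lt_succ_self _) h2 h1

lemma X_le_level {p : Ω × (ℕ → U)} (h : p ∈ D.unb) {i n : ℕ} (hn : n < D.N (i + 1) p) :
    D.X p n ≤ i := by
  have := (first_N (h (i + 1))).2 n hn
  push_cast at this
  omega

/-- The probability of a visit is at most the expected number of visits. Weighting by the inverse
rate at `-i` turns this into `timeAt`, so no bound on the rates is needed. -/
lemma lintegral_visit_le (i : ℕ) :
    ∫⁻ p, (⋃ n, D.visit i n).indicator (fun p => ((D.a (D.S (-(i : ℤ)) p.1) : ℝ≥0∞)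
      + D.b (D.S (-(i : ℤ)) p.1))⁻¹) p ∂D.Q ≤ ∫⁻ ξ, D.sTerm ξ i ∂D.P := by
  have hG : MeasurableSet (⋃ n, D.visit i n) := MeasurableSet.iUnion (D.measurableSet_visit i)
  have hw : Measurable fun p : Ω × (ℕ → U) => ((D.a (D.S (-(i : ℤ)) p.1) : ℝ≥0∞)
      + D.b (D.S (-(i : ℤ)) p.1))⁻¹ :=
    (((D.measurable_a.comp (D.measurable_S _)).coe_nnreal_ennreal.add
      (D.measurable_b.comp (D.measurable_S _)).coe_nnreal_ennreal).inv).comp measurable_fst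
  rw [lintegral_prod _ (hw.indicator hG).aemeasurable]
  refine lintegral_mono fun ξ => le_trans ?_ (D.timeAt_le ξ i)
  have h1 : ∀ ω, (⋃ n, D.visit i n).indicator (fun p => ((D.a (D.S (-(i : ℤ)) p.1) : ℝ≥0∞)
      + D.b (D.S (-(i : ℤ)) p.1))⁻¹) (ξ, ω)
      = (⋃ n, {ω | (ξ, ω) ∈ D.visit i n}).indicator (fun _ => ((D.a (D.S (-(i : ℤ)) ξ) : ℝ≥0∞)
      + D.b (D.S (-(i : ℤ)) ξ))⁻¹) ω := fun ω => by
    have hiff : (ξ, ω) ∈ ⋃ n, D.visit i n ↔ ω ∈ ⋃ n, {ω | (ξ, ω) ∈ D.visit i n} := by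
      rw [Set.mem_iUnion, Set.mem_iUnion]
      rfl
    by_cases hm : (ξ, ω) ∈ ⋃ n, D.visit i n
    · rw [Set.indicator_of_mem hm, Set.indicator_of_mem (hiff.1 hm)]
    · rw [Set.indicator_of_notMem hm, Set.indicator_of_notMem (mt hiff.2 hm)]
  simp_rw [h1]
  rw [lintegral_indicator_const
    (MeasurableSet.iUnion fun n => measurable_section (D.measurableSet_visit i n) ξ), timeAt,
    div_eq_mul_inv, mul_comm, green]
  gcongr
  exact measure_iUnion_le _

/-- Seen from level i, the origin is site `-i`, so the events are returns to the origin between the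
first visits to levels i and i + 1. Their weighted indicators have total mean at most `meanS`, hence
tend to 0 almost surely. -/
lemma ae_eventually_notMem_visit (hS : D.meanS ≠ ∞) :
    ∀ᵐ p ∂D.Q, ∀ᶠ i in atTop, ∀ n, D.Φ i p ∉ D.visit i n := by
  have h := D.unb_ae_of_meanS_ne_top hS
  have hmp := measurePreserving_Φ h
  let w : ℕ → Ω × (ℕ → U) → ℝ≥0∞ := fun i => (⋃ n, D.visit i n).indicator
    (fun p => ((D.a (D.S (-(i : ℤ)) p.1) : ℝ≥0∞) + D.b (D.S (-(i : ℤ)) p.1))⁻¹)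
  have hw : ∀ i, Measurable (w i) := fun i =>
    ((((D.measurable_a.comp (D.measurable_S _)).coe_nnreal_ennreal.add
      (D.measurable_b.comp (D.measurable_S _)).coe_nnreal_ennreal).inv).comp
        measurable_fst).indicator (MeasurableSet.iUnion (D.measurableSet_visit i))
  have hsum : ∫⁻ p, ∑' i, w i ((D.Φ 1)^[i] p) ∂D.Q ≠ ∞ := by
    rw [lintegral_tsum (f := fun i p => w i ((D.Φ 1)^[i] p)) fun i =>
      ((hw i).comp ((hmp.iterate i).measurable)).aemeasurable]
    refine ne_top_of_le_ne_top hS ?_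
    have h2 : ∑' i, ∫⁻ ξ, D.sTerm ξ i ∂D.P = D.meanS := by
      rw [meanS, ← lintegral_tsum]
      · rfl
      · intro i
        have ha : ∀ j : ℕ, Measurable fun ξ => (D.a (D.S (-(j : ℤ)) ξ) : ℝ≥0∞) := fun j =>
          (D.measurable_a.comp (D.measurable_S _)).coe_nnreal_ennreal
        have hb : ∀ j : ℕ, Measurable fun ξ => (D.b (D.S (-(j : ℤ)) ξ) : ℝ≥0∞) := fun j =>
          (D.measurable_b.comp (D.measurable_S _)).coe_nnreal_ennreal
        exact ((ha i).inv.mul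
          (Finset.measurable_prod _ fun j _ => (hb j).div (ha j))).aemeasurable
    rw [← h2]
    refine ENNReal.tsum_le_tsum fun i => ?_
    rw [(hmp.iterate i).lintegral_comp (hw i)]
    exact lintegral_visit_le i
  have hmeas : Measurable fun p => ∑' i, w i ((D.Φ 1)^[i] p) :=
    Measurable.tsum fun i => (hw i).comp (hmp.iterate i).measurable
  filter_upwards [h, ae_lt_top hmeas hsum] with p hp hfin
  have ht := ENNReal.tendsto_atTop_zero_of_tsum_ne_top hfin.ne
  -- After translation back, every weight is this number, which does not depend on `i`; so weights
  -- tending to 0 means no more visits.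
  have hpos : 0 < ((D.a p.1 : ℝ≥0∞) + D.b p.1)⁻¹ := ENNReal.inv_pos.2 (D.sum_rates_ne_top p.1)
  filter_upwards [ht.eventually_lt_const hpos] with i hi n hn
  rw [iterate_Φ hp] at hi
  simp only [w] at hi
  rw [Set.indicator_of_mem (Set.mem_iUnion.2 ⟨n, hn⟩), Φ_fst (hp i), D.S_neg_S] at hi
  exact lt_irrefl _ hi

lemma ae_bddBelow (hS : D.meanS ≠ ∞) : ∀ᵐ p ∂D.Q, ∃ K : ℕ, ∀ n, -(K : ℤ) ≤ D.X p n := by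
  filter_upwards [D.unb_ae_of_meanS_ne_top hS, ae_eventually_notMem_visit hS] with p hp hev
  obtain ⟨i₀, h₀⟩ := eventually_atTop.1 (hev.and (eventually_ge_atTop 1))
  have hi₀ : 1 ≤ i₀ := (h₀ i₀ le_rfl).2
  -- A zero at step `n` falls between the first visits to some levels `i` and `i + 1` with `i ≥ i₀`,
  -- and is an excluded return.
  have hne : ∀ n, D.N i₀ p ≤ n → D.X p n ≠ 0 := by
    intro n hn hX
    obtain ⟨i, hi, h1, h2⟩ := exists_level hp hn
    obtain ⟨m, rfl⟩ := Nat.exists_eq_add_of_le h1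
    have hf := first_N (hp i)
    have hadd : ∀ j, D.X p (D.N i p + j) = i + D.X (D.Φ i p) j := X_first_add hf
    refine (h₀ i hi).1 m ⟨fun j hj => ?_, ?_⟩
    · have := X_le_level hp (i := i) (n := D.N i p + j) (by omega)
      rw [hadd] at this
      omega
    · rw [hadd] at hX
      show D.X (D.Φ i p) m = -(i : ℤ)
      omega
  have hpos : ∀ m, 0 < D.X p (D.N i₀ p + m) := by
    intro m
    induction m with
    | zero =>
      have := (first_N (hp i₀)).1
      rw [add_zero]
      omega
    | succ m ih =>
      have h1 := D.le_X_succ p (D.N i₀ p + m)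
      have h2 := hne (D.N i₀ p + (m + 1)) (by omega)
      rw [← add_assoc] at h2 ⊢
      omega
  refine ⟨D.N i₀ p, fun n => ?_⟩
  rcases lt_or_ge n (D.N i₀ p) with hn | hn
  · have := D.neg_le_X p n
    omega
  · obtain ⟨m, rfl⟩ := Nat.exists_eq_add_of_le hn
    have := hpos m
    omega

variable (D)

/-- If i is the highest level reached so far, the position is at most i and the clock is at least
the hitting time of i. For a walk bounded above, divergence of the clock is enough. -/
lemma ae_eventually_mul_X_le {s : ℝ} (hs0 : 0 ≤ s) (hs : ENNReal.ofReal s < D.meanS) :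
    ∀ᵐ p ∂D.Q, ∀ᶠ n in atTop, s * D.X p n ≤ D.clk p n := by
  rcases D.unb_ae_or_bounded_ae with h | h
  · filter_upwards [h, ae_eventually_le_clk_N h hs0 hs] with p hp hev
    obtain ⟨i₀, h₀⟩ := eventually_atTop.1 hev
    filter_upwards [eventually_ge_atTop (D.N i₀ p)] with n hn
    obtain ⟨i, hi, h1, h2⟩ := exists_level hp hn
    have h3 : (D.X p n : ℝ) ≤ i := by exact_mod_cast X_le_level hp h2
    calc s * D.X p n ≤ s * i := by gcongr
      _ ≤ D.clk p (D.N i p) := h₀ i hi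
      _ ≤ D.clk p n := NNReal.coe_le_coe.2 (D.clk_mono p h1)
  · filter_upwards [h, D.ae_tendsto_clk] with p hp ht
    obtain ⟨k, hk⟩ := not_forall.1 hp
    filter_upwards [ht.eventually_ge_atTop (s * k)] with n hn
    refine le_trans ?_ hn
    have h3 : D.X p n ≤ k := le_of_lt (not_le.1 fun hc => hk ⟨n, hc⟩)
    have h4 : (D.X p n : ℝ) ≤ k := by exact_mod_cast h3
    gcongr

/-- Let i be the highest level reached. The next jump time is at most the hitting time of i + 1,
while the position is at least j - K, where j is the last good level before i; good levels have
density above d, so j is at least d i - 1. -/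
lemma ae_eventually_clk_le_mul_X (hS : D.meanS ≠ ∞) {s : ℝ} (hs : D.meanS.toReal < s) :
    ∀ᵐ p ∂D.Q, ∀ᶠ n in atTop, D.clk p (n + 1) ≤ s * D.X p n := by
  have h := D.unb_ae_of_meanS_ne_top hS
  obtain ⟨s', hs1, hs2⟩ := exists_between hs
  have hs' : 0 < s' := ENNReal.toReal_nonneg.trans_lt hs1
  have hs0 : 0 < s := hs'.trans hs2
  -- With `d > s' / s` the slope `s * d` exceeds `s'`, so the constants coming from `K` and the
  -- index shifts are eventually absorbed.
  obtain ⟨d, hd1, hd2⟩ := exists_between ((div_lt_one hs0).2 hs2)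
  have hd0 : 0 < d := (div_pos hs' hs0).trans hd1
  have hd : s' < s * d := by
    rw [div_lt_iff₀ hs0] at hd1
    linarith
  let B : ℕ → Set (Ω × (ℕ → U)) := fun K => {p | ∀ n, -(K : ℤ) ≤ D.X p n}
  have hBm : ∀ K, MeasurableSet (B K) := fun K => by
    have : B K = ⋂ n, {p | -(K : ℤ) ≤ D.X p n} := by
      ext p
      simp [B]
    rw [this]
    exact MeasurableSet.iInter fun n => measurableSet_le measurable_const (D.measurable_X n)
  have hBmono : Monotone B := fun K L hKL p hp n => by
    have := hp n
    omega
  have hlim := tendsto_measure_iUnion_atTop (μ := D.Q) hBmono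
  have hfull : D.Q (⋃ K, B K) = 1 := by
    rw [← mem_ae_iff_prob_eq_one (MeasurableSet.iUnion hBm)]
    filter_upwards [ae_bddBelow hS] with p ⟨K, hK⟩ using Set.mem_iUnion.2 ⟨K, hK⟩
  rw [hfull] at hlim
  obtain ⟨K, hK⟩ := (hlim.eventually_const_lt
    (show ENNReal.ofReal d < 1 by simpa using hd2)).exists
  have hgm : Measurable ((B K).indicator fun _ => (1 : ℝ)) := measurable_const.indicator (hBm K)
  have hg : Integrable ((B K).indicator fun _ => (1 : ℝ)) D.Q :=
    (integrable_const 1).indicator (hBm K)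
  have hint : d < ∫ p, (B K).indicator (fun _ => (1 : ℝ)) p ∂D.Q := by
    rw [integral_indicator_const _ (hBm K), smul_eq_mul, mul_one]
    exact (ENNReal.ofReal_lt_iff_lt_toReal hd0.le (measure_ne_top _ _)).1 hK
  filter_upwards [h, ae_eventually_clk_N_le h hS hs1,
    ae_eventually_le_birkhoffSum (ergodic_Φ h) hgm hg hint] with p hp hev1 hev2
  have hlin : ∀ᶠ k : ℕ in atTop, s' * (k + 1) ≤ s * (d * k - 1 - K) := by
    have ht : Tendsto (fun k : ℕ => (s * d - s') * (k : ℝ)) atTop atTop :=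
      tendsto_natCast_atTop_atTop.const_mul_atTop (sub_pos.2 hd)
    filter_upwards [ht.eventually_ge_atTop (s' + s + s * K)] with k hk
    linarith
  obtain ⟨i₀, h₀⟩ := eventually_atTop.1 (hev1.and (hev2.and (hlin.and (eventually_ge_atTop 1))))
  filter_upwards [eventually_ge_atTop (D.N i₀ p)] with n hn
  obtain ⟨i, hi, h1, h2⟩ := exists_level hp hn
  obtain ⟨-, hgood, hl, hi1⟩ := h₀ i hi
  have hclk := (h₀ (i + 1) (by omega)).1
  have hipos : (0 : ℝ) < i := by exact_mod_cast hi1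
  obtain ⟨j, hj, hj1, hj2⟩ := exists_lt_sum_indicator_le
    (good := fun j => (B K).indicator (fun _ => (1 : ℝ)) ((D.Φ 1)^[j] p))
    (fun j => by
      by_cases hm : (D.Φ 1)^[j] p ∈ B K
      · exact Or.inr (Set.indicator_of_mem hm _)
      · exact Or.inl (Set.indicator_of_notMem hm _)) i
    (lt_of_lt_of_le (mul_pos hd0 hipos) hgood)
  have hjB : D.Φ j p ∈ B K := by
    rw [← iterate_Φ hp]
    by_contra hc
    rw [Set.indicator_of_notMem hc] at hj1
    exact zero_ne_one hj1
  have hjn : D.N j p ≤ n := (N_mono hp hj.le).trans h1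
  obtain ⟨m, rfl⟩ := Nat.exists_eq_add_of_le hjn
  have hX : D.X p (D.N j p + m) = j + D.X (D.Φ j p) m := X_first_add (first_N (hp j)) m
  have hXge : (j : ℤ) - K ≤ D.X p (D.N j p + m) := by
    have := hjB m
    omega
  have hXge' : (j : ℝ) - K ≤ D.X p (D.N j p + m) := by exact_mod_cast hXge
  have hdj : d * i ≤ j + 1 := hgood.trans hj2
  calc (D.clk p (D.N j p + m + 1) : ℝ) ≤ D.clk p (D.N (i + 1) p) :=
        NNReal.coe_le_coe.2 (D.clk_mono p (by omega))
    _ ≤ s' * ((i + 1 : ℕ) : ℝ) := hclk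
    _ = s' * (i + 1) := by push_cast; rfl
    _ ≤ s * (d * i - 1 - K) := hl
    _ ≤ s * D.X p (D.N j p + m) := by
        gcongr
        linarith

/-- For infinite `meanS` the conventions `∞.toReal = 0` and `0⁻¹ = 0` give the correct threshold 0.
-/
lemma ae_eventually_X_le {v : ℝ} (hv : (D.meanS.toReal)⁻¹ < v) :
    ∀ᵐ p ∂D.Q, ∀ᶠ n in atTop, (D.X p n : ℝ) ≤ v * D.clk p n := by
  have hv0 : 0 < v := (inv_nonneg.2 ENNReal.toReal_nonneg).trans_lt hv
  have hs : ENNReal.ofReal v⁻¹ < D.meanS := by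
    rcases eq_or_ne D.meanS ∞ with h | h
    · rw [h]
      exact ENNReal.ofReal_lt_top
    · rw [ENNReal.ofReal_lt_iff_lt_toReal (inv_nonneg.2 hv0.le) h]
      exact inv_lt_of_inv_lt₀ (ENNReal.toReal_pos D.meanS_pos.ne' h) hv
  filter_upwards [D.ae_eventually_mul_X_le (inv_nonneg.2 hv0.le) hs] with p hp
  filter_upwards [hp] with n hn
  rwa [inv_mul_le_iff₀ hv0] at hn

lemma ae_eventually_le_X (hS : D.meanS ≠ ∞) {v : ℝ} (hv0 : 0 < v) (hv : v < (D.meanS.toReal)⁻¹) :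
    ∀ᵐ p ∂D.Q, ∀ᶠ n in atTop, v * D.clk p (n + 1) ≤ (D.X p n : ℝ) := by
  have hs : D.meanS.toReal < v⁻¹ :=
    (lt_inv_comm₀ hv0 (ENNReal.toReal_pos D.meanS_pos.ne' hS)).1 hv
  filter_upwards [D.ae_eventually_clk_le_mul_X hS hs] with p hp
  filter_upwards [hp] with n hn
  rwa [← le_inv_mul_iff₀ hv0]

/-- A finite `meanS` makes the walk unbounded above, a finite reflected one makes it bounded above.
-/
lemma meanS_eq_top_or_mirror : D.meanS = ∞ ∨ D.mirror.meanS = ∞ := by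
  by_contra! hc
  have h1 : ∀ᵐ p ∂D.Q, p ∈ D.unb := D.unb_ae_of_meanS_ne_top hc.1
  have h2 : ∀ᵐ p ∂D.Q, ∃ K : ℕ, ∀ n, -(K : ℤ) ≤ D.mirror.X p n := ae_bddBelow hc.2
  obtain ⟨p, hp1, K, hK⟩ := (h1.and h2).exists
  obtain ⟨n, hn⟩ := hp1 (K + 1)
  have := hK n
  rw [mirror_X] at this
  push_cast at hn
  omega

end WalkSystem

/-! ### From jump times to continuous time. -/

section TimeChange

variable {A : ℕ → ℝ} {Z : ℕ → ℤ}

lemma bddAbove_setOf_le (hA : Tendsto A atTop atTop) (t : ℝ) : BddAbove {n | A n ≤ t} := by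
  obtain ⟨m, hm⟩ := eventually_atTop.1 (hA.eventually_gt_atTop t)
  exact ⟨m, fun n hn => not_lt.1 fun hc => absurd hn (not_le.2 (hm n hc.le))⟩

lemma apply_sSup_le (h0 : A 0 = 0) (hA : Tendsto A atTop atTop) {t : ℝ} (ht : 0 ≤ t) :
    A (sSup {n | A n ≤ t}) ≤ t :=
  Nat.sSup_mem (s := {n | A n ≤ t}) ⟨0, h0.trans_le ht⟩ (bddAbove_setOf_le hA t)

lemma lt_apply_sSup_add_one (hA : Tendsto A atTop atTop) (t : ℝ) :
    t < A (sSup {n | A n ≤ t} + 1) := by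
  by_contra hc
  have := le_csSup (bddAbove_setOf_le hA t) (show _ ∈ {n | A n ≤ t} from not_lt.1 hc)
  omega

lemma tendsto_sSup_setOf_le (hA : Tendsto A atTop atTop) :
    Tendsto (fun t : ℝ => sSup {n | A n ≤ t}) atTop atTop := by
  refine tendsto_atTop.2 fun m => ?_
  filter_upwards [eventually_ge_atTop (A m)] with t ht
  exact le_csSup (bddAbove_setOf_le hA t) ht

lemma eventually_div_lt {v : ℝ} (h0 : A 0 = 0) (hA : Tendsto A atTop atTop) (hv : 0 ≤ v)
    (hup : ∀ q : ℚ, v < q → ∀ᶠ n in atTop, (Z n : ℝ) ≤ q * A n) {a : ℝ} (ha : v < a) :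
    ∀ᶠ t : ℝ in atTop, (Z (sSup {n | A n ≤ t}) : ℝ) / t < a := by
  obtain ⟨q, hq1, hq2⟩ := exists_rat_btwn ha
  filter_upwards [(tendsto_sSup_setOf_le hA).eventually (hup q hq1), eventually_gt_atTop 0]
    with t ht ht0
  refine lt_of_le_of_lt ?_ hq2
  rw [div_le_iff₀ ht0]
  exact ht.trans (mul_le_mul_of_nonneg_left (apply_sSup_le h0 hA ht0.le) (hv.trans hq1.le))

/-- The bound uses `A (n + 1)` because t lies below the jump time following the current step.
Rational slopes keep the null sets countable in number. -/
lemma eventually_lt_div {v : ℝ} (hA : Tendsto A atTop atTop) (hv : 0 < v)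
    (hlow : ∀ q : ℚ, (0 : ℝ) < q → q < v → ∀ᶠ n in atTop, q * A (n + 1) ≤ (Z n : ℝ)) {a : ℝ}
    (ha : a < v) :
    ∀ᶠ t : ℝ in atTop, a < (Z (sSup {n | A n ≤ t}) : ℝ) / t := by
  obtain ⟨q, hq1, hq2⟩ := exists_rat_btwn (max_lt ha hv)
  have hq0 : (0 : ℝ) < q := (le_max_right _ _).trans_lt hq1
  filter_upwards [(tendsto_sSup_setOf_le hA).eventually (hlow q hq0 hq2), eventually_gt_atTop 0]
    with t ht ht0
  refine ((le_max_left _ _).trans_lt hq1).trans_le ?_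
  rw [le_div_iff₀ ht0]
  exact (mul_le_mul_of_nonneg_left (lt_apply_sSup_add_one hA t).le hq0.le).trans ht

end TimeChange

/-! ### The law of large numbers in continuous time. -/

namespace WalkSystem

variable {Ω U : Type*} [MeasurableSpace Ω] [MeasurableSpace U] (D : WalkSystem Ω U)

/-- The walk in continuous time. -/
noncomputable def Y (p : Ω × (ℕ → U)) (t : ℝ) : ℤ := D.X p (sSup {n | (D.clk p n : ℝ) ≤ t})

lemma mirror_Y (p : Ω × (ℕ → U)) (t : ℝ) : D.mirror.Y p t = -D.Y p t := by
  rw [Y, mirror_X, mirror_clk, Y]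

lemma ae_eventually_Y_div_lt :
    ∀ᵐ p ∂D.Q, ∀ a, (D.meanS.toReal)⁻¹ < a → ∀ᶠ t : ℝ in atTop, (D.Y p t : ℝ) / t < a := by
  have h : ∀ q : ℚ, ∀ᵐ p ∂D.Q, (D.meanS.toReal)⁻¹ < q →
      ∀ᶠ n in atTop, (D.X p n : ℝ) ≤ q * D.clk p n := fun q => by
    by_cases hq : (D.meanS.toReal)⁻¹ < q
    · filter_upwards [D.ae_eventually_X_le hq] with p hp _ using hp
    · exact ae_of_all _ fun p hq' => absurd hq' hq
  filter_upwards [D.ae_tendsto_clk, ae_all_iff.2 h] with p ht hq a ha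
  exact eventually_div_lt (by simp [clk_zero]) ht (inv_nonneg.2 ENNReal.toReal_nonneg) hq ha

lemma ae_tendsto_Y_div_of_meanS_ne_top (hS : D.meanS ≠ ∞) :
    ∀ᵐ p ∂D.Q, Tendsto (fun t : ℝ => (D.Y p t : ℝ) / t) atTop (𝓝 (D.meanS.toReal)⁻¹) := by
  have h : ∀ q : ℚ, ∀ᵐ p ∂D.Q, (0 : ℝ) < q → q < (D.meanS.toReal)⁻¹ →
      ∀ᶠ n in atTop, (q : ℝ) * D.clk p (n + 1) ≤ (D.X p n : ℝ) := fun q => by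
    by_cases hq : (0 : ℝ) < q ∧ q < (D.meanS.toReal)⁻¹
    · filter_upwards [D.ae_eventually_le_X hS hq.1 hq.2] with p hp _ _ using hp
    · exact ae_of_all _ fun p h0 h1 => absurd ⟨h0, h1⟩ hq
  filter_upwards [D.ae_tendsto_clk, ae_all_iff.2 h, D.ae_eventually_Y_div_lt] with p ht hq hup
  refine tendsto_order.2 ⟨fun a ha => ?_, hup⟩
  exact eventually_lt_div (A := fun n => (D.clk p n : ℝ)) ht
    (inv_pos.2 (ENNReal.toReal_pos D.meanS_pos.ne' hS)) hq ha

/-- The law of large numbers for the walk. -/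
theorem exists_velocity :
    ∃ v : ℝ, (∀ᵐ p ∂D.Q, Tendsto (fun t : ℝ => (D.Y p t : ℝ) / t) atTop (𝓝 v)) ∧
      (D.meanS < ∞ → v = (D.meanS.toReal)⁻¹) ∧
      (D.mirror.meanS < ∞ → v = -(D.mirror.meanS.toReal)⁻¹) ∧
      (D.meanS = ∞ → D.mirror.meanS = ∞ → v = 0) := by
  by_cases h1 : D.meanS = ∞
  · by_cases h2 : D.mirror.meanS = ∞
    · refine ⟨0, ?_, fun h => absurd h1 h.ne, fun h => absurd h2 h.ne, fun _ _ => rfl⟩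
      have hm : ∀ᵐ p ∂D.Q, ∀ a, (D.mirror.meanS.toReal)⁻¹ < a →
          ∀ᶠ t : ℝ in atTop, (D.mirror.Y p t : ℝ) / t < a := D.mirror.ae_eventually_Y_div_lt
      filter_upwards [D.ae_eventually_Y_div_lt, hm] with p hp1 hp2
      rw [h1] at hp1
      rw [h2] at hp2
      simp only [ENNReal.toReal_top, inv_zero] at hp1 hp2
      refine tendsto_order.2 ⟨fun a ha => ?_, hp1⟩
      filter_upwards [hp2 (-a) (neg_pos.2 ha)] with t ht
      rw [mirror_Y] at ht
      push_cast at ht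
      rw [neg_div] at ht
      exact neg_lt_neg_iff.1 ht
    · refine ⟨-(D.mirror.meanS.toReal)⁻¹, ?_, fun h => absurd h1 h.ne, fun _ => rfl,
        fun _ h => absurd h h2⟩
      have hm : ∀ᵐ p ∂D.Q, Tendsto (fun t : ℝ => (D.mirror.Y p t : ℝ) / t) atTop
        (𝓝 (D.mirror.meanS.toReal)⁻¹) := D.mirror.ae_tendsto_Y_div_of_meanS_ne_top h2
      filter_upwards [hm] with p hp
      refine hp.neg.congr fun t => ?_
      rw [mirror_Y]
      push_cast
      rw [neg_div, neg_neg]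
  · have h2 := D.meanS_eq_top_or_mirror.resolve_left h1
    exact ⟨(D.meanS.toReal)⁻¹, D.ae_tendsto_Y_div_of_meanS_ne_top h1, fun _ => rfl,
      fun h => absurd h2 h.ne, fun h => absurd h h1⟩

end WalkSystem

/-! ### The biased walk as an instance of the abstract system. -/

namespace BiasedWalk

/-- Translation of the environment. -/
def translate (x : ℤ) (ξ : Env) : Env := fun y => ξ (y + x)

lemma measurable_translate (x : ℤ) : Measurable (translate x) :=
  measurable_pi_lambda _ fun y => measurable_pi_apply (y + x)

lemma translate_zero (ξ : Env) : translate 0 ξ = ξ := by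
  funext y
  simp [translate]

lemma translate_add (x y : ℤ) (ξ : Env) : translate (x + y) ξ = translate x (translate y ξ) := by
  funext z
  simp [translate, add_assoc]

lemma translate_one : translate 1 = shift := rfl

lemma measurePreserving_translate {P : Measure Env} (h : MeasurePreserving shift P P) (x : ℤ) :
    MeasurePreserving (translate x) P P := by
  have hnat : ∀ n : ℕ, MeasurePreserving (translate n) P P := fun n => by
    induction n with
    | zero =>
      have : translate ((0 : ℕ) : ℤ) = id := funext translate_zero
      rw [this]
      exact MeasurePreserving.id P
    | succ n ih =>
      have : translate ((n + 1 : ℕ) : ℤ) = translate n ∘ shift :=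
        funext fun ξ => by
          rw [Nat.cast_add, Nat.cast_one, translate_add, translate_one]
          rfl
      rw [this]
      exact ih.comp h
  obtain ⟨n, rfl | rfl⟩ := Int.eq_nat_or_neg x
  · exact hnat n
  · refine ⟨measurable_translate _, ?_⟩
    conv_lhs => rw [← (hnat n).map_eq]
    rw [Measure.map_map (measurable_translate _) (measurable_translate _)]
    have : translate (-(n : ℤ)) ∘ translate n = id := funext fun ξ => by
      rw [Function.comp_apply, ← translate_add, neg_add_cancel, translate_zero]
      rfl
    rw [this, Measure.map_id]

lemma rateLeft_pos (lam : ℝ) (ξ : Env) (x : ℤ) : 0 < rateLeft lam ξ x :=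
  mul_pos (ξ x).1.2 (Real.exp_pos _)

lemma rateRight_pos (lam : ℝ) (ξ : Env) (x : ℤ) : 0 < rateRight lam ξ x :=
  mul_pos (ξ x).2.2 (Real.exp_pos _)

lemma measurable_rateLeft (lam : ℝ) (x : ℤ) : Measurable fun ξ => rateLeft lam ξ x :=
  (measurable_subtype_coe.comp (measurable_fst.comp (measurable_pi_apply x))).mul_const _

lemma measurable_rateRight (lam : ℝ) (x : ℤ) : Measurable fun ξ => rateRight lam ξ x :=
  (measurable_subtype_coe.comp (measurable_snd.comp (measurable_pi_apply x))).mul_const _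

/-- The law of one pair `(γ, W)` of the noise. -/
noncomputable abbrev markLaw : Measure (unitInterval × ℝ) :=
  (volume : Measure unitInterval).prod (expMeasure 1)

instance : IsProbabilityMeasure (expMeasure 1) := isProbabilityMeasure_expMeasure one_pos

lemma volume_unitInterval_le {q : ℝ} (h0 : 0 ≤ q) (h1 : q ≤ 1) :
    (volume : Measure unitInterval) {γ | (γ : ℝ) ≤ q} = ENNReal.ofReal q := by
  have : {γ : unitInterval | (γ : ℝ) ≤ q} = Set.Iic ⟨q, h0, h1⟩ := rfl
  rw [this, unitInterval.volume_Iic]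

lemma expMeasure_ae_nonneg : ∀ᵐ w ∂(expMeasure 1), 0 ≤ w := by
  rw [expMeasure, gammaMeasure, ae_iff, withDensity_apply _ (by measurability)]
  simp only [not_le]
  exact lintegral_gammaPDF_of_nonpos le_rfl

/-- Multiplying the exponential density by w gives the Gamma(2, 1) density, which has integral 1. -/
lemma lintegral_expMeasure : ∫⁻ w, ENNReal.ofReal w ∂(expMeasure 1) = 1 := by
  have hm : Measurable (gammaPDF 1 1) := (measurable_gammaPDFReal 1 1).ennreal_ofReal
  rw [expMeasure, gammaMeasure, lintegral_withDensity_eq_lintegral_mul _ hm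
    ENNReal.measurable_ofReal, ← lintegral_gammaPDF_eq_one (a := 2) (r := 1) two_pos one_pos]
  refine lintegral_congr fun w => ?_
  rw [Pi.mul_apply]
  rcases lt_or_ge w 0 with hw | hw
  · rw [gammaPDF_of_neg hw, gammaPDF_of_neg hw, zero_mul]
  · rw [gammaPDF_of_nonneg hw, gammaPDF_of_nonneg hw, ← ENNReal.ofReal_mul (by positivity)]
    congr 1
    have h2 : Real.Gamma 2 = 1 := by
      have := Real.Gamma_nat_eq_factorial 1
      rwa [Nat.cast_one, one_add_one_eq_two, Nat.factorial_one, Nat.cast_one] at this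
    rw [h2, Real.Gamma_one, show (2 : ℝ) - 1 = 1 by norm_num, Real.rpow_one, sub_self,
      Real.rpow_zero]
    norm_num
    ring

/-- The biased walk as a `WalkSystem`. -/
noncomputable def system (P : Measure Env) [IsProbabilityMeasure P] (herg : Ergodic shift P)
    (lam : ℝ) : WalkSystem Env (unitInterval × ℝ) where
  P := P
  μ := markLaw
  S := translate
  S_zero := translate_zero
  S_add := translate_add
  mp := measurePreserving_translate herg.toMeasurePreserving
  erg := herg
  J := {q | (q.2.1 : ℝ) ≤ rateRight lam q.1 0 / (rateLeft lam q.1 0 + rateRight lam q.1 0)}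
  measurableSet_J := by
    refine measurableSet_le (measurable_subtype_coe.comp (measurable_fst.comp measurable_snd)) ?_
    exact ((measurable_rateRight lam 0).div
      ((measurable_rateLeft lam 0).add (measurable_rateRight lam 0))).comp measurable_fst
  a ξ := (rateRight lam ξ 0).toNNReal
  b ξ := (rateLeft lam ξ 0).toNNReal
  measurable_a := (measurable_rateRight lam 0).real_toNNReal
  measurable_b := (measurable_rateLeft lam 0).real_toNNReal
  a_pos ξ := Real.toNNReal_pos.2 (rateRight_pos lam ξ 0)
  b_pos ξ := Real.toNNReal_pos.2 (rateLeft_pos lam ξ 0)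
  law ξ := by
    have ha := rateRight_pos lam ξ 0
    have hb := rateLeft_pos lam ξ 0
    have hset : {u : unitInterval × ℝ | (ξ, u) ∈ {q : Env × (unitInterval × ℝ) |
        (q.2.1 : ℝ) ≤ rateRight lam q.1 0 / (rateLeft lam q.1 0 + rateRight lam q.1 0)}}
        = {γ : unitInterval | (γ : ℝ) ≤ rateRight lam ξ 0 /
          (rateLeft lam ξ 0 + rateRight lam ξ 0)} ×ˢ Set.univ := by
      ext u
      exact (iff_of_eq (and_true _)).symm
    rw [hset, Measure.prod_prod, measure_univ, mul_one, volume_unitInterval_le (by positivity)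
      ((div_le_one (by positivity)).2 (by linarith)), ENNReal.ofReal_div_of_pos (by positivity),
      add_comm (rateLeft lam ξ 0), ENNReal.ofReal_add ha.le hb.le]
    rfl
  W u := u.2.toNNReal
  measurable_W := measurable_snd.real_toNNReal
  lintegral_W := by
    have h := lintegral_prod (μ := (volume : Measure unitInterval)) (ν := expMeasure 1)
      (fun u => ENNReal.ofReal u.2) measurable_snd.ennreal_ofReal.aemeasurable
    simp only [lintegral_expMeasure, lintegral_one, measure_univ] at h
    exact h

variable (P : Measure Env) [IsProbabilityMeasure P] (herg : Ergodic shift P) (lam : ℝ)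

lemma coe_system_a (ξ : Env) (x : ℤ) :
    ((system P herg lam).a (translate x ξ) : ℝ) = rateRight lam ξ x := by
  show ((rateRight lam ξ (0 + x)).toNNReal : ℝ) = _
  rw [zero_add, Real.coe_toNNReal _ (rateRight_pos lam ξ x).le]

lemma coe_system_b (ξ : Env) (x : ℤ) :
    ((system P herg lam).b (translate x ξ) : ℝ) = rateLeft lam ξ x := by
  show ((rateLeft lam ξ (0 + x)).toNNReal : ℝ) = _
  rw [zero_add, Real.coe_toNNReal _ (rateLeft_pos lam ξ x).le]

lemma system_X (ξ : Env) (ω : Noise) (n : ℕ) :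
    (system P herg lam).X (ξ, ω) n = jumpChain lam ξ ω n := by
  induction n with
  | zero => rfl
  | succ n ih =>
    rw [WalkSystem.X_succ, ih, jumpChain]
    have hJ : ((system P herg lam).S (jumpChain lam ξ ω n) ξ, ω n) ∈ (system P herg lam).J ↔
        ((ω n).1 : ℝ) ≤ rateRight lam ξ (jumpChain lam ξ ω n) /
          (rateLeft lam ξ (jumpChain lam ξ ω n) + rateRight lam ξ (jumpChain lam ξ ω n)) := by
      show ((ω n).1 : ℝ) ≤ rateRight lam ξ (0 + jumpChain lam ξ ω n) /
          (rateLeft lam ξ (0 + jumpChain lam ξ ω n) + rateRight lam ξ (0 + jumpChain lam ξ ω n)) ↔ _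
      rw [zero_add]
    simp only
    split_ifs with h
    · rw [WalkSystem.step_of_mem _ (hJ.2 h)]
    · rw [WalkSystem.step_of_notMem _ (mt hJ.1 h), sub_eq_add_neg]

/-- The system truncates the clocks by `Real.toNNReal`; this changes nothing for nonnegative marks,
which is almost every sequence. -/
lemma system_clk (ξ : Env) {ω : Noise} (hω : ∀ n, 0 ≤ (ω n).2) (n : ℕ) :
    ((system P herg lam).clk (ξ, ω) n : ℝ) = jumpTime lam ξ ω n := by
  rw [WalkSystem.clk, jumpTime, NNReal.coe_sum]
  refine Finset.sum_congr rfl fun k _ => ?_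
  rw [WalkSystem.hold, holdingTime, NNReal.coe_div, NNReal.coe_add]
  simp only [WalkSystem.after, system_X]
  have ha := coe_system_a P herg lam ξ (jumpChain lam ξ ω k)
  have hb := coe_system_b P herg lam ξ (jumpChain lam ξ ω k)
  have hS : (system P herg lam).S = translate := rfl
  rw [hS, ha, hb, add_comm (rateRight _ _ _)]
  congr 1
  exact Real.coe_toNNReal _ (hω k)

lemma system_Y (ξ : Env) {ω : Noise} (hω : ∀ n, 0 ≤ (ω n).2) (t : ℝ) :
    (system P herg lam).Y (ξ, ω) t = walk lam ξ ω t := by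
  rw [WalkSystem.Y, walk, system_X]
  simp_rw [system_clk P herg lam ξ hω]

lemma ae_noise_nonneg : ∀ᵐ ω ∂noiseLaw, ∀ n, 0 ≤ (ω n).2 := by
  rw [ae_all_iff]
  intro n
  have h : ∀ᵐ u ∂markLaw, 0 ≤ u.2 :=
    (measurePreserving_snd (μ := (volume : Measure unitInterval))
      (ν := expMeasure 1)).quasiMeasurePreserving.ae expMeasure_ae_nonneg
  exact (measurePreserving_eval_infinitePi (fun _ : ℕ => markLaw) n).quasiMeasurePreserving.ae h

lemma coe_eq_ofReal {x : ℝ≥0} {y : ℝ} (h : (x : ℝ) = y) : (x : ℝ≥0∞) = ENNReal.ofReal y := by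
  rw [← h, ENNReal.ofReal_coe_nnreal]

lemma system_sTerm (ξ : Env) (i : ℕ) : (system P herg lam).sTerm ξ i = ENNReal.ofReal
    (1 / rateRight lam ξ (-(i : ℤ)) * ∏ j ∈ Finset.range i, rho lam ξ (-(j : ℤ))) := by
  have hS : (system P herg lam).S = translate := rfl
  have ha := fun x => coe_eq_ofReal (coe_system_a P herg lam ξ x)
  have hb := fun x => coe_eq_ofReal (coe_system_b P herg lam ξ x)
  have hpos : ∀ x, 0 ≤ rho lam ξ x := fun x =>
    (div_pos (rateLeft_pos lam ξ x) (rateRight_pos lam ξ x)).le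
  rw [WalkSystem.sTerm, ENNReal.ofReal_mul (one_div_pos.2 (rateRight_pos lam ξ _)).le,
    ENNReal.ofReal_prod_of_nonneg fun j _ => hpos _]
  simp only [hS, ha, hb, one_div]
  rw [ENNReal.ofReal_inv_of_pos (rateRight_pos lam ξ _)]
  congr 1
  refine Finset.prod_congr rfl fun j _ => ?_
  rw [rho, ENNReal.ofReal_div_of_pos (rateRight_pos lam ξ _)]

/-- Reflection swaps the two rates and turns site `-i` into `i`, so Ŝ of the mirror is F̂. -/
lemma system_mirror_sTerm (ξ : Env) (i : ℕ) : (system P herg lam).mirror.sTerm ξ i =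
    ENNReal.ofReal
      (1 / rateLeft lam ξ (i : ℤ) * ∏ j ∈ Finset.range i, (rho lam ξ (j : ℤ))⁻¹) := by
  have hS : ∀ i : ℕ, (system P herg lam).mirror.S (-(i : ℤ)) ξ = translate i ξ := fun i => by
    show translate (- -(i : ℤ)) ξ = _
    rw [neg_neg]
  have ha : ∀ x, ((system P herg lam).mirror.b (translate x ξ) : ℝ≥0∞) = _ :=
    fun x => coe_eq_ofReal (coe_system_a P herg lam ξ x)
  have hb : ∀ x, ((system P herg lam).mirror.a (translate x ξ) : ℝ≥0∞) = _ :=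
    fun x => coe_eq_ofReal (coe_system_b P herg lam ξ x)
  have hpos : ∀ x, 0 ≤ (rho lam ξ x)⁻¹ := fun x =>
    inv_nonneg.2 (div_pos (rateLeft_pos lam ξ x) (rateRight_pos lam ξ x)).le
  rw [WalkSystem.sTerm, ENNReal.ofReal_mul (one_div_pos.2 (rateLeft_pos lam ξ _)).le,
    ENNReal.ofReal_prod_of_nonneg fun j _ => hpos _]
  simp only [hS, ha, hb, one_div]
  rw [ENNReal.ofReal_inv_of_pos (rateLeft_pos lam ξ _)]
  congr 1
  refine Finset.prod_congr rfl fun j _ => ?_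
  rw [rho, inv_div, ENNReal.ofReal_div_of_pos (rateLeft_pos lam ξ _)]

lemma system_meanS : (system P herg lam).meanS = ∫⁻ ξ, hatS lam ξ ∂P := by
  refine lintegral_congr fun ξ => ?_
  rw [WalkSystem.sSeries, tsum_eq_zero_add' ENNReal.summable, hatS]
  simp_rw [system_sTerm]
  simp

lemma system_mirror_meanS : (system P herg lam).mirror.meanS = ∫⁻ ξ, hatF lam ξ ∂P := by
  refine lintegral_congr fun ξ => ?_
  rw [WalkSystem.sSeries, tsum_eq_zero_add' ENNReal.summable, hatF]
  simp_rw [system_mirror_sTerm]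
  simp

end BiasedWalk

theorem proposition4p1 (P : Measure BiasedWalk.Env) [IsProbabilityMeasure P]
    -- the law of the environment is stationary and ergodic with respect to shifts
    (herg : Ergodic BiasedWalk.shift P)
    -- the expectation of `log ρ_0` is well defined in `[-∞, ∞]`
    (hlog : ∫⁻ ξ, ENNReal.ofReal (Real.log (BiasedWalk.rho 0 ξ 0)) ∂P < ∞ ∨
      ∫⁻ ξ, ENNReal.ofReal (-Real.log (BiasedWalk.rho 0 ξ 0)) ∂P < ∞)
    (lam : ℝ) :
    ∃ v : ℝ,
      (∀ᵐ p ∂(P.prod BiasedWalk.noiseLaw),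
        Tendsto (BiasedWalk.jumpTime lam p.1 p.2) atTop atTop ∧
        Tendsto (fun t : ℝ => (BiasedWalk.walk lam p.1 p.2 t : ℝ) / t) atTop (𝓝 v)) ∧
      (∫⁻ ξ, BiasedWalk.hatS lam ξ ∂P < ∞ →
        v = 1 / (∫⁻ ξ, BiasedWalk.hatS lam ξ ∂P).toReal) ∧
      (∫⁻ ξ, BiasedWalk.hatF lam ξ ∂P < ∞ →
        v = -(1 / (∫⁻ ξ, BiasedWalk.hatF lam ξ ∂P).toReal)) ∧
      (∫⁻ ξ, BiasedWalk.hatS lam ξ ∂P = ∞ → ∫⁻ ξ, BiasedWalk.hatF lam ξ ∂P = ∞ → v = 0) := by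
  obtain ⟨v, hv, hS, hF, h0⟩ := (BiasedWalk.system P herg lam).exists_velocity
  rw [BiasedWalk.system_meanS] at hS h0
  rw [BiasedWalk.system_mirror_meanS] at hF h0
  refine ⟨v, ?_, by simpa only [one_div] using hS, by simpa only [one_div] using hF, h0⟩
  have hpos : ∀ᵐ p ∂(P.prod BiasedWalk.noiseLaw), ∀ n, 0 ≤ (p.2 n).2 :=
    Measure.quasiMeasurePreserving_snd.ae BiasedWalk.ae_noise_nonneg
  filter_upwards [hpos, hv, (BiasedWalk.system P herg lam).ae_tendsto_clk] with p hp h1 h2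
  refine ⟨h2.congr (BiasedWalk.system_clk P herg lam p.1 hp), h1.congr fun t => ?_⟩
  have := BiasedWalk.system_Y P herg lam p.1 hp t
  rw [← this]
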